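/- Let $d\ge 1$, let $\theta$ be a real antisymmetric $d\times d$ matrix, and let $b>0$, $m>0$. On $L^2(\mathbb R^d)$ consider the Weyl operators $(U_\theta(t)\xi)(r)=e^{i(t,r)}\xi(r-\tfrac12\theta t)$ and, for $f\in\mathcal S(\mathbb R^d)$, put $\lambda_\theta(f)=\int_{\mathbb R^d}f(t)U_\theta(t)\,dt$. Let $\mathcal S(\mathbb R^d_\theta)=\{\lambda_\theta(f):f\in\mathcal S(\mathbb R^d)\}$ with the topology carried over from $\mathcal S(\mathbb R^d)$, let $\mathcal S'(\mathbb R^d_\theta)$ be its topological dual, let $\tau_\theta$ be the trace with $\tau_\theta(\lambda_\theta(f))=f(0)$, and let $L^2(\mathbb R^d_\theta)$ be the completion of $\mathcal S(\mathbb R^d_\theta)$ in the norm $\|x\|_{L^2}=\tau_\theta(x^*x)^{1/2}$, paired with $\mathcal S(\mathbb R^d_\theta)$ by $\langle x,y\rangle=\tau_\theta(xy)$. Let $\Delta_\theta=\sum_j(\partial_j^\theta)^2$ with $\partial^\theta_j\lambda_\theta(f)=\lambda_\theta(it_jf)$, let $(1-\Delta_\theta)^{\gamma/2}\lambda_\theta(f)=\lambda_\theta((1+|\cdot|^2)^{\gamma/2}f)$,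 and extend both to $\mathcal S'(\mathbb R^d_\theta)$ by duality. For $\gamma\in\mathbb R$ let $$\mathcal H^\gamma(\mathbb R^d_\theta)=\{x\in\mathcal S'(\mathbb R^d_\theta):(1-\Delta_\theta)^{\gamma/2}x\in L^2(\mathbb R^d_\theta)\},\qquad \|x\|_{\mathcal H^\gamma}=\|(1-\Delta_\theta)^{\gamma/2}x\|_{L^2(\mathbb R^d_\theta)}.$$ Consider the Cauchy problem $$\partial_t^2x(t)-\Delta_\theta x(t)+b\,\partial_tx(t)+m\,x(t)=0\quad(t>0),\qquad x(0)=x_0,\quad \partial_tx(0)=x_1,$$ where a solution is a function $x$ on $[0,\infty)$ that, for some $r\in\mathbb R$, is continuously differentiable on $[0,\infty)$ and twice differentiable on $(0,\infty)$ with values in $\mathcal H^r(\mathbb R^d_\theta)$ (time derivatives being limits of difference quotients in the norm of $\mathcal H^r$) and satisfies the equation in $\mathcal S'(\mathbb R^d_\theta)$. Then there is $\delta>0$ such that the following hold. 1. For every $s\in\mathbb R$ there is $C>0$ such that for all $x_0\in\mathcal H^s(\mathbb R^d_\theta)$ and $x_1\in\mathcal H^{s-1}(\mathbb R^d_\theta)$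 the problem has a solution, and every solution $x$ satisfies, for all $t>0$, $x(t)\in\mathcal H^s(\mathbb R^d_\theta)$ and $$\|x(t)\|_{\mathcal H^s}\le C e^{-\delta t}\left(\|x_0\|_{\mathcal H^s}+\|x_1\|_{\mathcal H^{s-1}}\right).$$ 2. For every $s\in\mathbb R$ and every integer $\alpha\ge 0$ there is $C>0$ such that for all $x_0\in\mathcal H^{\alpha+s}(\mathbb R^d_\theta)$ and $x_1\in\mathcal H^{\alpha+s-1}(\mathbb R^d_\theta)$ every solution $x$ is $\alpha$ times differentiable on $(0,\infty)$ in the norm of $\mathcal H^s(\mathbb R^d_\theta)$ and satisfies, for all $t>0$, $\partial_t^\alpha x(t)\in\mathcal H^s(\mathbb R^d_\theta)$ and $$\|\partial_t^\alpha x(t)\|_{\mathcal H^s}\le C e^{-\delta t}\left(\|x_0\|_{\mathcal H^{\alpha+s}}+\|x_1\|_{\mathcal H^{\alpha+s-1}}\right).$$ -/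

import Mathlib

open MeasureTheory Filter Topology
open scoped SchwartzMap ENNReal ComplexConjugate

noncomputable section

namespace NCEuclidean

/-- Real antisymmetric `d × d` matrices. -/
abbrev SkewMatrix (d : ℕ) : Type := {θ : Matrix (Fin d) (Fin d) ℝ // θ.transpose = -θ}

/-- The Euclidean space `ℝ^d`. -/
abbrev Space (d : ℕ) : Type := EuclideanSpace ℝ (Fin d)

/-- The Hilbert space `L²(ℝ^d)`. -/
abbrev Hilb (d : ℕ) : Type := Lp ℂ 2 (volume : Measure (Space d))

variable {d : ℕ}

/-- The action of `θ` on vectors. -/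
def SkewMatrix.act (θ : SkewMatrix d) : Space d →L[ℝ] Space d :=
  Matrix.toEuclideanCLM (𝕜 := ℝ) θ.1

theorem SkewMatrix.inner_act (θ : SkewMatrix d) (t s : Space d) :
    inner ℝ (θ.act t) s = -inner ℝ t (θ.act s) := by
  have h1 : inner ℝ (θ.act t) s = inner ℝ t ((star θ.act) s) := by
    rw [ContinuousLinearMap.star_eq_adjoint, ContinuousLinearMap.adjoint_inner_right]
  have h2 : star θ.act = -θ.act := by
    unfold SkewMatrix.act
    rw [← map_star, ← map_neg]
    congr 1
    rw [Matrix.star_eq_conjTranspose, Matrix.conjTranspose_eq_transpose_of_trivial]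
    exact θ.2
  rw [h1, h2]
  exact inner_neg_right _ _

theorem SkewMatrix.inner_act_self (θ : SkewMatrix d) (t : Space d) :
    inner ℝ (θ.act t) t = 0 := by
  have h := θ.inner_act t t
  rw [real_inner_comm] at h
  rw [real_inner_comm]
  linarith

/-- The unimodular function `s ↦ e^{i (t, s)}`. -/
def phase (t s : Space d) : ℂ := Complex.exp (Complex.I * (inner ℝ t s : ℝ))

theorem norm_phase (t s : Space d) : ‖phase t s‖ = 1 := by
  rw [phase, mul_comm, Complex.norm_exp_ofReal_mul_I]

theorem continuous_phase : Continuous fun p : Space d × Space d => phase p.1 p.2 := by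
  unfold phase; fun_prop

theorem phase_add_left (t t' s : Space d) : phase (t + t') s = phase t s * phase t' s := by
  simp only [phase, ← Complex.exp_add, inner_add_left]; push_cast; ring_nf

theorem phase_add_right (t s s' : Space d) : phase t (s + s') = phase t s * phase t s' := by
  simp only [phase, ← Complex.exp_add, inner_add_right]; push_cast; ring_nf

theorem phase_zero_left (s : Space d) : phase 0 s = 1 := by simp [phase]

theorem phase_zero_right (s : Space d) : phase s 0 = 1 := by simp [phase]

theorem phase_comm (t s : Space d) : phase t s = phase s t := by
  simp [phase, real_inner_comm]

theorem memLp_modTrans (t w : Space d) (ξ : Hilb d) :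
    MemLp (fun s => phase t s * ξ (s - w)) 2 (volume : Measure (Space d)) := by
  have h1 : MemLp (fun s => ξ (s - w)) 2 (volume : Measure (Space d)) :=
    (Lp.memLp ξ).comp_measurePreserving (measurePreserving_sub_right volume w)
  have hc : Continuous fun s : Space d => phase t s :=
    continuous_phase.comp (by fun_prop : Continuous fun s : Space d => (t, s))
  refine h1.of_le (hc.aestronglyMeasurable.mul h1.1) (ae_of_all _ fun s => ?_)
  rw [norm_mul, norm_phase, one_mul]

/-- The isometry `ξ ↦ (s ↦ e^{i (t, s)} ξ(s - w))` of `L²(ℝ^d)`. -/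
def modTrans (t w : Space d) : Hilb d →ₗᵢ[ℂ] Hilb d where
  toFun ξ := (memLp_modTrans t w ξ).toLp
  map_add' ξ η := by
    rw [← MemLp.toLp_add]
    refine MemLp.toLp_congr _ _ ?_
    have h := (measurePreserving_sub_right volume w).quasiMeasurePreserving.ae (Lp.coeFn_add ξ η)
    filter_upwards [h] with s hs
    simp only [Pi.add_apply] at hs ⊢
    rw [hs, mul_add]
  map_smul' c ξ := by
    simp only [RingHom.id_apply]
    rw [← MemLp.toLp_const_smul]
    refine MemLp.toLp_congr _ _ ?_
    have h := (measurePreserving_sub_right volume w).quasiMeasurePreserving.ae (Lp.coeFn_smul c ξ)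
    filter_upwards [h] with s hs
    simp only [Pi.smul_apply, smul_eq_mul] at hs ⊢
    rw [hs]; ring
  norm_map' ξ := by
    change ‖(memLp_modTrans t w ξ).toLp‖ = ‖ξ‖
    rw [Lp.norm_toLp, Lp.norm_def]
    congr 1
    rw [← eLpNorm_comp_measurePreserving (p := 2) (Lp.aestronglyMeasurable ξ)
      (measurePreserving_sub_right volume w)]
    refine eLpNorm_congr_norm_ae (ae_of_all _ fun s => ?_)
    rw [norm_mul, norm_phase, one_mul]; rfl

theorem modTrans_ae (t w : Space d) (ξ : Hilb d) :
    modTrans t w ξ =ᵐ[volume] fun s => phase t s * ξ (s - w) :=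
  (memLp_modTrans t w ξ).coeFn_toLp

theorem modTrans_modTrans (t w t' w' : Space d) (ξ : Hilb d) :
    modTrans t w (modTrans t' w' ξ) = phase t' (-w) • modTrans (t + t') (w + w') ξ := by
  refine Lp.ext ?_
  have h := (measurePreserving_sub_right volume w).quasiMeasurePreserving.ae (modTrans_ae t' w' ξ)
  filter_upwards [modTrans_ae t w (modTrans t' w' ξ), h, modTrans_ae (t + t') (w + w') ξ,
    Lp.coeFn_smul (phase t' (-w)) (modTrans (t + t') (w + w') ξ)] with s h1 h2 h3 h4
  rw [h1, h2, h4, Pi.smul_apply, h3, phase_add_left, sub_eq_add_neg s w, phase_add_right,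
    smul_eq_mul]
  have : s + -w - w' = s - (w + w') := by abel
  rw [this]; ring

theorem modTrans_zero (ξ : Hilb d) : modTrans 0 0 ξ = ξ := by
  refine Lp.ext ?_
  filter_upwards [modTrans_ae 0 0 ξ] with s h1
  rw [h1, phase_zero_left, one_mul, sub_zero]

theorem continuous_mod (η : Hilb d) : Continuous fun t : Space d => modTrans t 0 η := by
  rw [continuous_iff_continuousAt]
  intro t₀
  have key : ∀ t, ‖modTrans t 0 η - modTrans t₀ 0 η‖ ^ 2
      = ∫ s, ‖phase t s - phase t₀ s‖ ^ 2 * ‖η s‖ ^ 2 := by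
    intro t
    rw [← inner_self_eq_norm_sq (𝕜 := ℂ), L2.inner_def, ← integral_re (L2.integrable_inner _ _)]
    refine integral_congr_ae ?_
    filter_upwards [Lp.coeFn_sub (modTrans t 0 η) (modTrans t₀ 0 η), modTrans_ae t 0 η,
      modTrans_ae t₀ 0 η] with s h1 h2 h3
    rw [inner_self_eq_norm_sq, h1, Pi.sub_apply, h2, h3, sub_zero, ← sub_mul, norm_mul, mul_pow]
  have hint : Integrable (fun s => ‖η s‖ ^ 2) (volume : Measure (Space d)) :=
    (Lp.memLp η).integrable_norm_pow (by norm_num)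
  have hcont : Continuous fun t : Space d => ∫ s, ‖phase t s - phase t₀ s‖ ^ 2 * ‖η s‖ ^ 2 := by
    refine continuous_of_dominated (bound := fun s => 4 * ‖η s‖ ^ 2) ?_ ?_ (hint.const_mul 4) ?_
    · intro t
      refine AEStronglyMeasurable.mul ?_ hint.1
      refine Continuous.aestronglyMeasurable ?_
      have h1 := continuous_phase.comp (by fun_prop : Continuous fun s : Space d => (t, s))
      have h2 := continuous_phase.comp (by fun_prop : Continuous fun s : Space d => (t₀, s))
      exact ((h1.sub h2).norm.pow 2)
    · intro t
      refine ae_of_all _ fun s => ?_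
      have : ‖phase t s - phase t₀ s‖ ≤ 2 := by
        refine (norm_sub_le _ _).trans ?_
        rw [norm_phase, norm_phase]; norm_num
      rw [Real.norm_of_nonneg (by positivity)]
      gcongr
      nlinarith [norm_nonneg (phase t s - phase t₀ s)]
    · refine ae_of_all _ fun s => ?_
      have h1 := continuous_phase.comp (by fun_prop : Continuous fun t : Space d => (t, s))
      exact ((h1.sub continuous_const).norm.pow 2).mul continuous_const
  have h0 : Tendsto (fun t => ‖modTrans t 0 η - modTrans t₀ 0 η‖ ^ 2) (𝓝 t₀) (𝓝 0) := by
    simp_rw [key]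
    have := hcont.tendsto t₀
    simpa using this
  rw [ContinuousAt, tendsto_iff_norm_sub_tendsto_zero]
  have := h0.sqrt
  simpa using this

theorem continuous_trans (η : Hilb d) : Continuous fun w : Space d => modTrans 0 w η := by
  let g : Space d → C(Space d, Space d) := fun w => ⟨fun s => s - w, by fun_prop⟩
  have hg : Continuous g := ContinuousMap.continuous_of_continuous_uncurry _ (by
    change Continuous fun p : Space d × Space d => p.2 - p.1
    fun_prop)
  have h := (continuous_const (y := η)).compMeasurePreservingLp hg
    (μ := volume) (fun w => measurePreserving_sub_right volume w) (by norm_num)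
  refine h.congr fun w => ?_
  refine Lp.ext ?_
  filter_upwards [modTrans_ae 0 w η, Lp.coeFn_compMeasurePreserving η
    (measurePreserving_sub_right volume w)] with s h1 h2
  rw [h1, phase_zero_left, one_mul]
  exact h2

theorem norm_modTrans_sub_le (t w t₀ w₀ : Space d) (ξ : Hilb d) :
    ‖modTrans t w ξ - modTrans t₀ w₀ ξ‖ ≤ ‖modTrans 0 w ξ - modTrans 0 w₀ ξ‖
      + ‖modTrans t 0 (modTrans 0 w₀ ξ) - modTrans t₀ 0 (modTrans 0 w₀ ξ)‖ := by
  have hdec : ∀ t w : Space d, modTrans t w ξ = modTrans t 0 (modTrans 0 w ξ) := by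
    intro t w
    rw [modTrans_modTrans, phase_zero_left, one_smul, add_zero, zero_add]
  rw [hdec t w, hdec t₀ w₀]
  generalize modTrans 0 w ξ = a
  generalize modTrans 0 w₀ ξ = b
  have h1 : modTrans t 0 a - modTrans t₀ 0 b
      = modTrans t 0 (a - b) + (modTrans t 0 b - modTrans t₀ 0 b) := by
    rw [map_sub]; abel
  rw [h1]
  refine (norm_add_le _ _).trans ?_
  rw [LinearIsometry.norm_map]

theorem continuous_modTrans (ξ : Hilb d) {X : Type*} [TopologicalSpace X] {t w : X → Space d}
    (ht : Continuous t) (hw : Continuous w) : Continuous fun p => modTrans (t p) (w p) ξ := by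
  rw [continuous_iff_continuousAt]
  intro p₀
  rw [ContinuousAt, tendsto_iff_norm_sub_tendsto_zero]
  have h1 : Continuous fun p => ‖modTrans 0 (w p) ξ - modTrans 0 (w p₀) ξ‖ :=
    (((continuous_trans ξ).comp hw).sub continuous_const).norm
  have h2 : Continuous fun p => ‖modTrans (t p) 0 (modTrans 0 (w p₀) ξ)
      - modTrans (t p₀) 0 (modTrans 0 (w p₀) ξ)‖ :=
    (((continuous_mod (modTrans 0 (w p₀) ξ)).comp ht).sub continuous_const).norm
  have h3 := (h1.add h2).tendsto p₀
  simp only [Pi.add_apply, sub_self, norm_zero, add_zero] at h3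
  exact squeeze_zero (fun _ => norm_nonneg _) (fun p => norm_modTrans_sub_le _ _ _ _ ξ) h3

/-- The Weyl operators `(U_θ(t)ξ)(s) = e^{i (t, s)} ξ(s - θt/2)` on `L²(ℝ^d)`. -/
def weyl (θ : SkewMatrix d) (t : Space d) : Hilb d →ₗᵢ[ℂ] Hilb d :=
  modTrans t ((1 / 2 : ℝ) • θ.act t)

theorem continuous_weyl (θ : SkewMatrix d) (ξ : Hilb d) : Continuous fun t => weyl θ t ξ :=
  continuous_modTrans ξ continuous_id (by fun_prop)

/-- The Weyl relation `U_θ(t) U_θ(s) = e^{i (t, θs) / 2} U_θ(t + s)`. -/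
theorem weyl_weyl (θ : SkewMatrix d) (t s : Space d) (ξ : Hilb d) :
    weyl θ t (weyl θ s ξ) = phase t ((1 / 2 : ℝ) • θ.act s) • weyl θ (t + s) ξ := by
  unfold weyl
  rw [modTrans_modTrans, map_add, smul_add]
  congr 1
  unfold phase
  congr 3
  rw [inner_neg_right, real_inner_smul_right, real_inner_smul_right, real_inner_comm,
    θ.inner_act t s]
  ring

theorem weyl_zero (θ : SkewMatrix d) (ξ : Hilb d) : weyl θ 0 ξ = ξ := by
  unfold weyl
  rw [map_zero, smul_zero, modTrans_zero]

theorem weyl_neg_weyl (θ : SkewMatrix d) (t : Space d) (ξ : Hilb d) :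
    weyl θ t (weyl θ (-t) ξ) = ξ := by
  rw [weyl_weyl, add_neg_cancel, weyl_zero]
  have : phase t ((1 / 2 : ℝ) • θ.act (-t)) = 1 := by
    unfold phase
    rw [real_inner_smul_right, map_neg, inner_neg_right, real_inner_comm, θ.inner_act_self]
    simp
  rw [this, one_smul]

theorem integrable_smul_weyl (θ : SkewMatrix d) {f : Space d → ℂ} (hf : Integrable f)
    (ξ : Hilb d) : Integrable fun t => f t • weyl θ t ξ := by
  refine (hf.norm.mul_const ‖ξ‖).mono' (hf.1.smul (continuous_weyl θ ξ).aestronglyMeasurable) ?_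
  refine ae_of_all _ fun t => ?_
  rw [norm_smul, LinearIsometry.norm_map]

/-- The operator `λ_θ(f)`, that is `λ_θ(f)ξ = ∫ f(t) U_θ(t)ξ dt`, for a Schwartz function `f`. -/
def weylTransform (θ : SkewMatrix d) : 𝓢(Space d, ℂ) →ₗ[ℂ] (Hilb d →L[ℂ] Hilb d) where
  toFun f := LinearMap.mkContinuous
    { toFun := fun ξ => ∫ t, f t • weyl θ t ξ
      map_add' := fun ξ η => by
        simp only [map_add, smul_add]
        exact integral_add (integrable_smul_weyl θ f.integrable ξ)
          (integrable_smul_weyl θ f.integrable η)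
      map_smul' := fun c ξ => by
        simp only [map_smul, RingHom.id_apply]
        rw [← integral_smul]
        simp only [smul_comm c] }
    (∫ t, ‖f t‖) (fun ξ => by
      change ‖∫ t, f t • weyl θ t ξ‖ ≤ _
      refine (norm_integral_le_integral_norm _).trans (le_of_eq ?_)
      rw [← integral_mul_const]
      simp only [norm_smul, LinearIsometry.norm_map])
  map_add' f g := by
    ext1 ξ
    change ∫ t, (f t + g t) • weyl θ t ξ = (∫ t, f t • weyl θ t ξ) + ∫ t, g t • weyl θ t ξ
    simp only [add_smul]
    exact integral_add (integrable_smul_weyl θ f.integrable ξ)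
      (integrable_smul_weyl θ g.integrable ξ)
  map_smul' c f := by
    ext1 ξ
    change ∫ t, (c * f t) • weyl θ t ξ = c • ∫ t, f t • weyl θ t ξ
    simp only [mul_smul]
    exact integral_smul c _

theorem weylTransform_apply (θ : SkewMatrix d) (f : 𝓢(Space d, ℂ)) (ξ : Hilb d) :
    weylTransform θ f ξ = ∫ t, f t • weyl θ t ξ := rfl

/-- `a = λ_θ(f)` for a continuous integrable function `f`. -/
def IsWeylTransform (θ : SkewMatrix d) (f : Space d → ℂ) (a : Hilb d →L[ℂ] Hilb d) : Prop :=
  Continuous f ∧ Integrable f ∧ ∀ ξ, a ξ = ∫ t, f t • weyl θ t ξ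

theorem isWeylTransform (θ : SkewMatrix d) (f : 𝓢(Space d, ℂ)) :
    IsWeylTransform θ f (weylTransform θ f) :=
  ⟨f.continuous, f.integrable, fun _ => rfl⟩

/-- The translation `T_η(a)`: the conjugation of `a` by the unitary `ξ ↦ ξ(· + η)`. -/
def translate (η : Space d) (a : Hilb d →L[ℂ] Hilb d) : Hilb d →L[ℂ] Hilb d :=
  (modTrans 0 (-η)).toContinuousLinearMap ∘L a ∘L (modTrans 0 η).toContinuousLinearMap

/-- `T_η(U_θ(t)) = e^{i (η, t)} U_θ(t)`. -/
theorem translate_weyl (θ : SkewMatrix d) (η t : Space d) :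
    translate η (weyl θ t).toContinuousLinearMap
      = phase η t • (weyl θ t).toContinuousLinearMap := by
  ext1 ξ
  change modTrans 0 (-η) (weyl θ t (modTrans 0 η ξ)) = phase η t • weyl θ t ξ
  unfold weyl
  rw [modTrans_modTrans, modTrans_modTrans, phase_zero_left, one_smul, neg_neg, zero_add,
    add_zero, phase_comm]
  congr 3
  abel

theorem translate_apply_of_isWeylTransform {θ : SkewMatrix d} {f : Space d → ℂ}
    {a : Hilb d →L[ℂ] Hilb d} (h : IsWeylTransform θ f a) (η : Space d) (ξ : Hilb d) :
    translate η a ξ = ∫ t, (phase η t * f t) • weyl θ t ξ := by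
  change modTrans 0 (-η) (a (modTrans 0 η ξ)) = _
  rw [h.2.2, ← LinearIsometry.integral_comp_comm]
  refine integral_congr_ae (ae_of_all _ fun t => ?_)
  have := congrArg (fun A : Hilb d →L[ℂ] Hilb d => A ξ) (translate_weyl θ η t)
  change modTrans 0 (-η) (weyl θ t (modTrans 0 η ξ)) = phase η t • weyl θ t ξ at this
  simp only [map_smul]
  rw [this, smul_smul, mul_comm]

theorem exists_hilb_ne_zero (d : ℕ) : ∃ ξ : Hilb d, ξ ≠ 0 := by
  have hm : (volume : Measure (Space d)) (Metric.ball 0 1) ≠ ∞ := measure_ball_lt_top.ne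
  refine ⟨indicatorConstLp 2 measurableSet_ball hm (1 : ℂ), fun h => ?_⟩
  have h1 := congrArg (fun x : Hilb d => ‖x‖) h
  simp only [norm_zero] at h1
  rw [norm_indicatorConstLp (by norm_num) (by norm_num), norm_one, one_mul] at h1
  have h2 : 0 < (volume : Measure (Space d)).real (Metric.ball 0 1) :=
    ENNReal.toReal_pos (Metric.measure_ball_pos _ _ one_pos).ne' hm
  exact (Real.rpow_pos_of_pos h2 _).ne' h1

theorem isWeylTransform_zero {θ : SkewMatrix d} {f : Space d → ℂ}
    (h : IsWeylTransform θ f 0) : f = 0 := by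
  obtain ⟨ξ, hξ⟩ := exists_hilb_ne_zero d
  funext t₀
  set G : Space d → ℂ := fun t => f t * inner ℂ (weyl θ t₀ ξ) (weyl θ t ξ) with hG
  have hGc : Continuous G := h.1.mul (continuous_const.inner (continuous_weyl θ ξ))
  have hGi : Integrable G := by
    refine (h.2.1.norm.mul_const (‖ξ‖ * ‖ξ‖)).mono' hGc.aestronglyMeasurable
      (ae_of_all _ fun t => ?_)
    rw [hG, norm_mul]
    gcongr
    refine (norm_inner_le_norm _ _).trans (le_of_eq ?_)
    rw [LinearIsometry.norm_map, LinearIsometry.norm_map]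
  have hF : FourierTransform.fourier G = 0 := by
    funext v
    rw [Real.fourier_eq']
    have h1 := translate_apply_of_isWeylTransform h (-(2 * Real.pi) • v) ξ
    have h2 : translate (-(2 * Real.pi) • v) (0 : Hilb d →L[ℂ] Hilb d) ξ = 0 := by
      change modTrans 0 _ ((0 : Hilb d →L[ℂ] Hilb d) _) = 0
      rw [zero_apply, map_zero]
    rw [h2] at h1
    have hint : Integrable fun t => (phase (-(2 * Real.pi) • v) t * f t) • weyl θ t ξ := by
      refine integrable_smul_weyl θ ?_ ξ
      have hc : Continuous fun t : Space d => phase (-(2 * Real.pi) • v) t :=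
        continuous_phase.comp (by fun_prop : Continuous fun t : Space d =>
          ((-(2 * Real.pi) • v : Space d), t))
      refine h.2.1.norm.mono' (hc.mul h.1).aestronglyMeasurable (ae_of_all _ fun t => ?_)
      rw [norm_mul, norm_phase, one_mul]
    have h3 := integral_inner (𝕜 := ℂ) hint (weyl θ t₀ ξ)
    rw [← h1, inner_zero_right] at h3
    rw [Pi.zero_apply, ← h3]
    refine integral_congr_ae (ae_of_all _ fun t => ?_)
    simp only [hG, inner_smul_right, smul_eq_mul, ← mul_assoc]
    congr 2
    unfold phase
    congr 1
    rw [real_inner_smul_left, real_inner_comm]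
    push_cast
    ring
  have h4 := hGc.fourierInv_fourier_eq hGi (by rw [hF]; exact integrable_zero _ _ _)
  rw [hF] at h4
  have h5 : G t₀ = 0 := by
    rw [← h4, Real.fourierInv_eq']
    simp
  rw [hG] at h5
  simp only [inner_self_eq_norm_sq_to_K, LinearIsometry.norm_map] at h5
  rcases mul_eq_zero.1 h5 with h6 | h6
  · exact h6
  · exfalso
    apply hξ
    simpa using h6

theorem IsWeylTransform.unique {θ : SkewMatrix d} {f g : Space d → ℂ}
    {a : Hilb d →L[ℂ] Hilb d} (hf : IsWeylTransform θ f a) (hg : IsWeylTransform θ g a) :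
    f = g := by
  have h : IsWeylTransform θ (f - g) 0 := by
    refine ⟨hf.1.sub hg.1, hf.2.1.sub hg.2.1, fun ξ => ?_⟩
    simp only [Pi.sub_apply, sub_smul]
    rw [integral_sub (integrable_smul_weyl θ hf.2.1 ξ) (integrable_smul_weyl θ hg.2.1 ξ),
      ← hf.2.2, ← hg.2.2, sub_self, zero_apply]
  exact sub_eq_zero.1 (isWeylTransform_zero h)

theorem weylTransform_injective (θ : SkewMatrix d) : Function.Injective (weylTransform θ) := by
  intro f g h
  have hg := isWeylTransform θ g
  rw [← h] at hg
  exact DFunLike.coe_injective ((isWeylTransform θ f).unique hg)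

theorem IsWeylTransform.adjoint {θ : SkewMatrix d} {f : Space d → ℂ}
    {a : Hilb d →L[ℂ] Hilb d} (h : IsWeylTransform θ f a) :
    IsWeylTransform θ (fun t => conj (f (-t))) (ContinuousLinearMap.adjoint a) := by
  have hi : Integrable fun t => conj (f (-t)) := by
    have h1 : Integrable fun t => f (-t) := h.2.1.comp_neg
    exact (h1.norm).mono' (Complex.continuous_conj.comp (h.1.comp continuous_neg)).aestronglyMeasurable
      (ae_of_all _ fun t => by simp)
  refine ⟨Complex.continuous_conj.comp (h.1.comp continuous_neg), hi, fun ξ => ?_⟩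
  refine ext_inner_left ℂ fun ζ => ?_
  rw [ContinuousLinearMap.adjoint_inner_right, h.2.2,
    ← integral_inner (integrable_smul_weyl θ hi ξ), ← inner_conj_symm, ← integral_inner (integrable_smul_weyl θ h.2.1 ζ), ← integral_conj,
    ← integral_neg_eq_self]
  refine integral_congr_ae (ae_of_all _ fun t => ?_)
  simp only [inner_smul_right, map_mul, inner_conj_symm]
  congr 1
  conv_lhs => rw [← weyl_neg_weyl θ (-t) ξ, LinearIsometry.inner_map_map, neg_neg]

/-- The `θ`-convolution. -/
def twist (θ : SkewMatrix d) (f g : Space d → ℂ) (r : Space d) : ℂ :=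
  ∫ t, f t * g (r - t) * phase t ((1 / 2 : ℝ) • θ.act r)

theorem IsWeylTransform.mul {θ : SkewMatrix d} {f g : Space d → ℂ}
    {a b : Hilb d →L[ℂ] Hilb d} (hf : IsWeylTransform θ f a) (hg : IsWeylTransform θ g b)
    {B : ℝ} (hB : ∀ t, ‖g t‖ ≤ B) : IsWeylTransform θ (twist θ f g) (a ∘L b) := by
  have hfc := hf.1
  have hgc := hg.1
  have hphase : Continuous fun p : Space d × Space d => phase p.2 ((1 / 2 : ℝ) • θ.act p.1) :=
    continuous_phase.comp (by fun_prop : Continuous fun p : Space d × Space d =>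
      (p.2, (1 / 2 : ℝ) • θ.act p.1))
  have hkc : Continuous fun p : Space d × Space d =>
      f p.2 * g (p.1 - p.2) * phase p.2 ((1 / 2 : ℝ) • θ.act p.1) := by
    fun_prop
  have hconv : Integrable (fun p : Space d × Space d => f p.2 * g (p.1 - p.2))
      (volume.prod volume) :=
    Integrable.convolution_integrand (ContinuousLinearMap.mul ℂ ℂ) hf.2.1 hg.2.1
  have hki : Integrable (fun p : Space d × Space d =>
      f p.2 * g (p.1 - p.2) * phase p.2 ((1 / 2 : ℝ) • θ.act p.1)) (volume.prod volume) := by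
    refine hconv.norm.mono' hkc.aestronglyMeasurable (ae_of_all _ fun p => ?_)
    rw [norm_mul, norm_phase, mul_one]
  refine ⟨?_, hki.integral_prod_left, fun ξ => ?_⟩
  · unfold twist
    refine continuous_of_dominated (bound := fun t => ‖f t‖ * B) (fun r => ?_) (fun r => ?_)
      (hf.2.1.norm.mul_const B) (ae_of_all _ fun t => ?_)
    · exact (hkc.comp (by fun_prop : Continuous fun t : Space d => (r, t))).aestronglyMeasurable
    · refine ae_of_all _ fun t => ?_
      rw [norm_mul, norm_phase, mul_one, norm_mul]
      gcongr
      exact hB _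
    · exact hkc.comp (by fun_prop : Continuous fun r : Space d => (r, t))
  · have hki2 : Integrable (fun p : Space d × Space d =>
        (f p.2 * g (p.1 - p.2) * phase p.2 ((1 / 2 : ℝ) • θ.act p.1)) • weyl θ p.1 ξ)
        (volume.prod volume) := by
      refine (hki.norm.mul_const ‖ξ‖).mono'
        (hkc.smul ((continuous_weyl θ ξ).comp continuous_fst)).aestronglyMeasurable
        (ae_of_all _ fun p => ?_)
      rw [norm_smul, LinearIsometry.norm_map]
    have h1 : ∀ r, twist θ f g r • weyl θ r ξ
        = ∫ t, (f t * g (r - t) * phase t ((1 / 2 : ℝ) • θ.act r)) • weyl θ r ξ := by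
      intro r
      rw [integral_smul_const]; rfl
    simp only [h1]
    rw [integral_integral_swap hki2]
    change a (b ξ) = _
    rw [hf.2.2]
    refine integral_congr_ae (ae_of_all _ fun t => ?_)
    simp only
    rw [hg.2.2, ← LinearIsometry.integral_comp_comm, ← integral_smul]
    rw [← integral_sub_right_eq_self _ t]
    refine integral_congr_ae (ae_of_all _ fun r => ?_)
    simp only [map_smul]
    rw [weyl_weyl, smul_smul, smul_smul, add_sub_cancel]
    congr 2
    unfold phase
    congr 3
    rw [map_sub, smul_sub, inner_sub_right, real_inner_smul_right _ (θ.act t),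
      real_inner_comm, real_inner_comm (θ.act t), θ.inner_act_self]
    simp

theorem twist_zero (θ : SkewMatrix d) (f g : Space d → ℂ) :
    twist θ f g 0 = ∫ t, f t * g (-t) := by
  simp [twist, phase_zero_right]

/-- The Schwartz space `𝒮(ℝ^d_θ) = {λ_θ(f) : f ∈ 𝒮(ℝ^d)}`, a space of bounded operators on
`L²(ℝ^d)`. -/
def NCSchwartz (θ : SkewMatrix d) : Type := LinearMap.range (weylTransform θ)

instance (θ : SkewMatrix d) : AddCommGroup (NCSchwartz θ) :=
  inferInstanceAs (AddCommGroup (LinearMap.range (weylTransform θ)))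

instance (θ : SkewMatrix d) : Module ℂ (NCSchwartz θ) :=
  inferInstanceAs (Module ℂ (LinearMap.range (weylTransform θ)))

/-- An element of `𝒮(ℝ^d_θ)` as an operator. -/
def NCSchwartz.op {θ : SkewMatrix d} : NCSchwartz θ →ₗ[ℂ] (Hilb d →L[ℂ] Hilb d) :=
  (LinearMap.range (weylTransform θ)).subtype

/-- `λ_θ` as a linear bijection from `𝒮(ℝ^d)` onto `𝒮(ℝ^d_θ)`. -/
def weylEquiv (θ : SkewMatrix d) : 𝓢(Space d, ℂ) ≃ₗ[ℂ] NCSchwartz θ :=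
  LinearEquiv.ofInjective (weylTransform θ) (weylTransform_injective θ)

theorem op_weylEquiv (θ : SkewMatrix d) (f : 𝓢(Space d, ℂ)) :
    (weylEquiv θ f).op = weylTransform θ f := rfl

/-- The topology carried over from `𝒮(ℝ^d)` by `λ_θ`. -/
instance (θ : SkewMatrix d) : TopologicalSpace (NCSchwartz θ) :=
  TopologicalSpace.induced (weylEquiv θ).symm inferInstance

instance (θ : SkewMatrix d) : IsTopologicalAddGroup (NCSchwartz θ) :=
  topologicalAddGroup_induced (weylEquiv θ).symm

instance (θ : SkewMatrix d) : ContinuousSMul ℂ (NCSchwartz θ) :=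
  continuousSMul_induced (weylEquiv θ).symm.toLinearMap

/-- The Fourier transform `x ↦ x̂ = λ_θ⁻¹(x)`. -/
def ncFourier (θ : SkewMatrix d) : NCSchwartz θ ≃L[ℂ] 𝓢(Space d, ℂ) where
  toLinearEquiv := (weylEquiv θ).symm
  continuous_toFun := continuous_induced_dom
  continuous_invFun := by
    refine continuous_induced_rng.2 ?_
    refine continuous_id.congr fun f => ?_
    exact ((weylEquiv θ).symm_apply_apply f).symm

theorem isWeylTransform_op {θ : SkewMatrix d} (x : NCSchwartz θ) :
    IsWeylTransform θ (ncFourier θ x) x.op := by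
  obtain ⟨f, rfl⟩ := (weylEquiv θ).surjective x
  have : ncFourier θ (weylEquiv θ f) = f := (weylEquiv θ).symm_apply_apply f
  rw [this]
  exact isWeylTransform θ f

open Classical in
/-- The trace `τ_θ(∫ f(t) U_θ(t) dt) = f(0)`, for continuous integrable `f` (this covers
the products of elements of `𝒮(ℝ^d_θ)`); it is `0` by convention on other operators. -/
def ncTrace (θ : SkewMatrix d) (a : Hilb d →L[ℂ] Hilb d) : ℂ :=
  if h : ∃ f, IsWeylTransform θ f a then h.choose 0 else 0

theorem IsWeylTransform.ncTrace_eq {θ : SkewMatrix d} {f : Space d → ℂ}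
    {a : Hilb d →L[ℂ] Hilb d} (h : IsWeylTransform θ f a) : ncTrace θ a = f 0 := by
  have hex : ∃ f, IsWeylTransform θ f a := ⟨f, h⟩
  rw [ncTrace, dif_pos hex, hex.choose_spec.unique h]

theorem exists_norm_le (f : 𝓢(Space d, ℂ)) : ∃ B : ℝ, ∀ t, ‖f t‖ ≤ B := by
  obtain ⟨B, -, hB⟩ := f.decay 0 0
  exact ⟨B, fun t => by simpa using hB t⟩

theorem ncTrace_mul {θ : SkewMatrix d} (x y : NCSchwartz θ) :
    ncTrace θ (x.op ∘L y.op) = ∫ t, ncFourier θ x t * ncFourier θ y (-t) := by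
  obtain ⟨B, hB⟩ := exists_norm_le (ncFourier θ y)
  rw [((isWeylTransform_op x).mul (isWeylTransform_op y) hB).ncTrace_eq, twist_zero]

theorem ncTrace_adjoint_mul {θ : SkewMatrix d} (x y : NCSchwartz θ) :
    ncTrace θ (ContinuousLinearMap.adjoint x.op ∘L y.op)
      = ∫ t, conj (ncFourier θ x t) * ncFourier θ y t := by
  obtain ⟨B, hB⟩ := exists_norm_le (ncFourier θ y)
  rw [((isWeylTransform_op x).adjoint.mul (isWeylTransform_op y) hB).ncTrace_eq, twist_zero,
    ← integral_neg_eq_self]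
  simp only [neg_neg]

theorem integrable_conj_mul (f g : 𝓢(Space d, ℂ)) : Integrable fun t => conj (f t) * g t := by
  obtain ⟨B, hB⟩ := exists_norm_le f
  refine (g.integrable.norm.const_mul B).mono'
    ((Complex.continuous_conj.comp f.continuous).mul g.continuous).aestronglyMeasurable
    (ae_of_all _ fun t => ?_)
  rw [norm_mul, RCLike.norm_conj]
  gcongr
  exact hB t

theorem integral_conj_mul_self (f : 𝓢(Space d, ℂ)) :
    ∫ t, conj (f t) * f t = ((∫ t, ‖f t‖ ^ 2 : ℝ) : ℂ) := by
  rw [← integral_complex_ofReal]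
  refine integral_congr_ae (ae_of_all _ fun t => ?_)
  simp only [Complex.conj_mul', Complex.ofReal_pow]

/-- `𝒮(ℝ^d_θ)` with the norm `‖x‖ = τ_θ(x* x)^{1/2}`. -/
def PreL2 (θ : SkewMatrix d) : Type := NCSchwartz θ

instance (θ : SkewMatrix d) : AddCommGroup (PreL2 θ) :=
  inferInstanceAs (AddCommGroup (NCSchwartz θ))

instance (θ : SkewMatrix d) : Module ℂ (PreL2 θ) :=
  inferInstanceAs (Module ℂ (NCSchwartz θ))

/-- The identity map from `PreL2 θ` to `𝒮(ℝ^d_θ)`. -/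
def PreL2.toSchwartz {θ : SkewMatrix d} : PreL2 θ ≃ₗ[ℂ] NCSchwartz θ :=
  LinearEquiv.refl ℂ (NCSchwartz θ)

/-- The inner product `(x, y) ↦ τ_θ(x* y)`. -/
@[reducible]
def innerCore (θ : SkewMatrix d) : InnerProductSpace.Core ℂ (PreL2 θ) where
  inner x y := ncTrace θ (ContinuousLinearMap.adjoint x.toSchwartz.op ∘L y.toSchwartz.op)
  conj_inner_symm x y := by
    rw [ncTrace_adjoint_mul, ncTrace_adjoint_mul, ← integral_conj]
    refine integral_congr_ae (ae_of_all _ fun t => ?_)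
    simp only [map_mul, Complex.conj_conj]
    ring
  re_inner_nonneg x := by
    rw [ncTrace_adjoint_mul, integral_conj_mul_self]
    exact integral_nonneg fun t => by positivity
  add_left x y z := by
    simp only [ncTrace_adjoint_mul]
    rw [← integral_add (integrable_conj_mul _ _) (integrable_conj_mul _ _)]
    refine integral_congr_ae (ae_of_all _ fun t => ?_)
    simp only [map_add, add_apply, add_mul]
  smul_left x y r := by
    simp only [ncTrace_adjoint_mul]
    rw [← integral_const_mul]
    refine integral_congr_ae (ae_of_all _ fun t => ?_)
    simp only [map_smul, smul_apply, smul_eq_mul, map_mul, mul_assoc]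
  definite x h := by
    rw [ncTrace_adjoint_mul, integral_conj_mul_self] at h
    have h1 : ∫ t, ‖ncFourier θ x.toSchwartz t‖ ^ 2 = 0 := by exact_mod_cast h
    have hc : Continuous fun t => ‖ncFourier θ x.toSchwartz t‖ ^ 2 :=
      (ncFourier θ x.toSchwartz).continuous.norm.pow 2
    have hi : Integrable fun t => ‖ncFourier θ x.toSchwartz t‖ ^ 2 := by
      refine (integrable_conj_mul (ncFourier θ x.toSchwartz) (ncFourier θ x.toSchwartz)).norm.congr
        (ae_of_all _ fun t => ?_)
      simp only [norm_mul, RCLike.norm_conj, sq]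
    rw [integral_eq_zero_iff_of_nonneg (fun t => by positivity) hi] at h1
    have h2 := (hc.ae_eq_iff_eq volume continuous_zero).1 h1
    have h3 : ncFourier θ x.toSchwartz = 0 := by
      ext t
      have := congrFun h2 t
      simpa using this
    have h4 : x.toSchwartz = 0 := (ncFourier θ).map_eq_zero_iff.1 h3
    exact PreL2.toSchwartz.map_eq_zero_iff.1 h4

instance (θ : SkewMatrix d) : NormedAddCommGroup (PreL2 θ) :=
  (innerCore θ).toNormedAddCommGroup

instance (θ : SkewMatrix d) : InnerProductSpace ℂ (PreL2 θ) :=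
  InnerProductSpace.ofCore (innerCore θ).toCore

theorem inner_preL2 {θ : SkewMatrix d} (x y : PreL2 θ) : inner ℂ x y
    = ncTrace θ (ContinuousLinearMap.adjoint x.toSchwartz.op ∘L y.toSchwartz.op) := rfl

theorem norm_preL2 {θ : SkewMatrix d} (x : PreL2 θ) :
    ‖x‖ = √(∫ t, ‖ncFourier θ x.toSchwartz t‖ ^ 2) := by
  rw [@norm_eq_sqrt_re_inner ℂ, inner_preL2, ncTrace_adjoint_mul, integral_conj_mul_self]
  rfl

/-- The space `L²(ℝ^d_θ)`: the completion of `𝒮(ℝ^d_θ)` in the norm `τ_θ(x* x)^{1/2}`. -/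
abbrev NCL2 (θ : SkewMatrix d) : Type := UniformSpace.Completion (PreL2 θ)

/-- The pairing `⟨v, y⟩ = τ_θ(v y)` of `v ∈ L²(ℝ^d_θ)` with `y ∈ 𝒮(ℝ^d_θ)`, extended by
continuity from `v ∈ 𝒮(ℝ^d_θ)`. -/
def l2Pairing (θ : SkewMatrix d) (v : NCL2 θ) (y : NCSchwartz θ) : ℂ :=
  UniformSpace.Completion.extension
    (fun x : PreL2 θ => ncTrace θ (x.toSchwartz.op ∘L y.op)) v

theorem norm_ncTrace_mul_le {θ : SkewMatrix d} (x : PreL2 θ) (y : NCSchwartz θ) :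
    ‖ncTrace θ (x.toSchwartz.op ∘L y.op)‖ ≤ ‖x‖ * √(∫ t, ‖ncFourier θ y t‖ ^ 2) := by
  set f := ncFourier θ x.toSchwartz with hf
  set g := ncFourier θ y with hg
  have hg2 : MemLp (fun t => g (-t)) (ENNReal.ofReal 2) (volume : Measure (Space d)) :=
    (g.memLp _ volume).comp_measurePreserving (Measure.measurePreserving_neg volume)
  have h := integral_mul_norm_le_Lp_mul_Lq (μ := (volume : Measure (Space d)))
    (f := fun t => f t) (g := fun t => g (-t)) Real.HolderConjugate.two_two
    (f.memLp _ volume) hg2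
  rw [ncTrace_mul, norm_preL2, ← hf, ← hg, Real.sqrt_eq_rpow, Real.sqrt_eq_rpow]
  refine (norm_integral_le_integral_norm _).trans ?_
  simp only [norm_mul]
  refine h.trans (le_of_eq ?_)
  have h1 : ∫ t, ‖g (-t)‖ ^ (2 : ℝ) = ∫ t, ‖g t‖ ^ (2 : ℝ) :=
    integral_neg_eq_self (fun t => ‖g t‖ ^ (2 : ℝ)) volume
  rw [h1]
  simp only [Real.rpow_two]

theorem uniformContinuous_pairing {θ : SkewMatrix d} (y : NCSchwartz θ) :
    UniformContinuous fun x : PreL2 θ => ncTrace θ (x.toSchwartz.op ∘L y.op) := by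
  refine (LipschitzWith.of_dist_le_mul
    (K := (√(∫ t, ‖ncFourier θ y t‖ ^ 2)).toNNReal) fun x x' => ?_).uniformContinuous
  rw [dist_eq_norm, dist_eq_norm, Real.coe_toNNReal _ (Real.sqrt_nonneg _), mul_comm]
  refine le_trans (le_of_eq ?_) (norm_ncTrace_mul_le (x - x') y)
  congr 1
  have hint : ∀ x : PreL2 θ,
      Integrable fun t => ncFourier θ x.toSchwartz t * ncFourier θ y (-t) := by
    intro x
    obtain ⟨B, hB⟩ := exists_norm_le (ncFourier θ y)
    refine ((ncFourier θ x.toSchwartz).integrable.norm.mul_const B).mono'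
      ((ncFourier θ x.toSchwartz).continuous.mul
        ((ncFourier θ y).continuous.comp continuous_neg)).aestronglyMeasurable
      (ae_of_all _ fun t => ?_)
    rw [norm_mul]
    gcongr
    exact hB _
  rw [ncTrace_mul, ncTrace_mul, ncTrace_mul, ← integral_sub (hint x) (hint x')]
  refine integral_congr_ae (ae_of_all _ fun t => ?_)
  simp only [map_sub, sub_apply, sub_mul]

theorem l2Pairing_coe {θ : SkewMatrix d} (x : PreL2 θ) (y : NCSchwartz θ) :
    l2Pairing θ x y = ncTrace θ (x.toSchwartz.op ∘L y.op) :=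
  UniformSpace.Completion.extension_coe (uniformContinuous_pairing y) x

/-- The tempered distributions `𝒮'(ℝ^d_θ)`: the continuous linear functionals on
`𝒮(ℝ^d_θ)`. -/
abbrev NCDual (θ : SkewMatrix d) : Type := NCSchwartz θ →L[ℂ] ℂ

/-- The Fourier multiplier `λ_θ(f) ↦ λ_θ(g f)` on `𝒮(ℝ^d_θ)`, for a smooth symbol `g` of
temperate growth. -/
def multiplier (θ : SkewMatrix d) (g : Space d → ℂ) : NCSchwartz θ →L[ℂ] NCSchwartz θ :=
  (ncFourier θ).symm.toContinuousLinearMap ∘L SchwartzMap.smulLeftCLM ℂ g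
    ∘L (ncFourier θ).toContinuousLinearMap

/-- The partial derivative `∂_j λ_θ(f) = λ_θ(i t_j f)`. -/
def partialDeriv (θ : SkewMatrix d) (j : Fin d) : NCSchwartz θ →L[ℂ] NCSchwartz θ :=
  multiplier θ fun t => Complex.I * (t j : ℂ)

theorem op_apply {θ : SkewMatrix d} (x : NCSchwartz θ) (ξ : Hilb d) :
    x.op ξ = ∫ t, ncFourier θ x t • weyl θ t ξ := (isWeylTransform_op x).2.2 ξ

theorem ncFourier_multiplier {θ : SkewMatrix d} {g : Space d → ℂ}
    (hg : g.HasTemperateGrowth) (x : NCSchwartz θ) (t : Space d) :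
    ncFourier θ (multiplier θ g x) t = g t * ncFourier θ x t := by
  have h : ncFourier θ (multiplier θ g x) = SchwartzMap.smulLeftCLM ℂ g (ncFourier θ x) :=
    (ncFourier θ).apply_symm_apply _
  rw [h, SchwartzMap.smulLeftCLM_apply_apply hg, smul_eq_mul]

theorem hasTemperateGrowth_coord (j : Fin d) :
    (fun t : Space d => Complex.I * (t j : ℂ)).HasTemperateGrowth :=
  (Complex.I • (Complex.ofRealCLM ∘L EuclideanSpace.proj j : Space d →L[ℝ] ℂ)).hasTemperateGrowth

theorem norm_exp_sub_le (a : ℝ) :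
    ‖Complex.exp (Complex.I * a) - 1 - Complex.I * a‖ ≤ 3 * a ^ 2 := by
  have hn : ‖Complex.I * (a : ℂ)‖ = |a| := by simp
  rcases le_or_gt |a| 1 with h | h
  · have := Complex.norm_exp_sub_one_sub_id_le (x := Complex.I * a) (by rw [hn]; exact h)
    rw [hn, sq_abs] at this
    nlinarith [sq_nonneg a]
  · have h1 : ‖Complex.exp (Complex.I * a)‖ = 1 := by
      rw [mul_comm, Complex.norm_exp_ofReal_mul_I]
    have h2 := norm_sub_le (Complex.exp (Complex.I * a) - 1) (Complex.I * a)
    have h3 := norm_sub_le (Complex.exp (Complex.I * a)) 1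
    rw [h1, norm_one] at h3
    rw [hn] at h2
    rw [← sq_abs]
    nlinarith

/-- `∂_j` is the generator of the translations in the `j`-th direction. -/
theorem hasDerivAt_translate {θ : SkewMatrix d} (j : Fin d) (x : NCSchwartz θ) :
    HasDerivAt (fun h : ℝ => translate (h • EuclideanSpace.single j (1 : ℝ)) x.op)
      (partialDeriv θ j x).op 0 := by
  set f := ncFourier θ x with hf
  set M : ℝ := ∫ t, ‖t‖ ^ 2 * ‖f t‖ with hM
  have hg := hasTemperateGrowth_coord j
  have hin : ∀ (h : ℝ) (t : Space d),
      inner ℝ (h • EuclideanSpace.single j (1 : ℝ)) t = h * t j := by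
    intro h t
    rw [real_inner_smul_left, EuclideanSpace.inner_single_left]
    simp
  have key : ∀ h : ℝ, ‖translate (h • EuclideanSpace.single j (1 : ℝ)) x.op - x.op
      - h • (partialDeriv θ j x).op‖ ≤ 3 * M * h ^ 2 := by
    intro h
    have hM0 : 0 ≤ M := integral_nonneg fun t => by positivity
    refine ContinuousLinearMap.opNorm_le_bound _ (by positivity) fun ξ => ?_
    have hpi : Integrable fun t : Space d =>
        phase (h • EuclideanSpace.single j (1 : ℝ)) t * f t := by
      have hc : Continuous fun t : Space d => phase (h • EuclideanSpace.single j (1 : ℝ)) t :=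
        continuous_phase.comp (by fun_prop : Continuous fun t : Space d =>
          ((h • EuclideanSpace.single j (1 : ℝ) : Space d), t))
      refine f.integrable.norm.mono' (hc.mul f.continuous).aestronglyMeasurable
        (ae_of_all _ fun t => ?_)
      rw [norm_mul, norm_phase, one_mul]
    have e1 : (translate (h • EuclideanSpace.single j (1 : ℝ)) x.op - x.op
        - h • (partialDeriv θ j x).op) ξ
        = ∫ t, (phase (h • EuclideanSpace.single j (1 : ℝ)) t * f t - f t
          - h • ncFourier θ (partialDeriv θ j x) t) • weyl θ t ξ := by
      change translate (h • EuclideanSpace.single j (1 : ℝ)) x.op ξ - x.op ξ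
        - h • (partialDeriv θ j x).op ξ = _
      rw [translate_apply_of_isWeylTransform (isWeylTransform_op x), op_apply, op_apply,
        ← integral_smul, ← integral_sub (integrable_smul_weyl θ hpi ξ)
          (integrable_smul_weyl θ f.integrable ξ), ← integral_sub]
      · refine integral_congr_ae (ae_of_all _ fun t => ?_)
        simp only [sub_smul, smul_assoc]
      · exact (integrable_smul_weyl θ hpi ξ).sub (integrable_smul_weyl θ f.integrable ξ)
      · exact (integrable_smul_weyl θ (ncFourier θ (partialDeriv θ j x)).integrable ξ).smul h
    rw [e1]
    have hMi : Integrable fun t : Space d => 3 * h ^ 2 * (‖t‖ ^ 2 * ‖f t‖) * ‖ξ‖ :=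
      ((f.integrable_pow_mul volume 2).const_mul _).mul_const _
    refine (norm_integral_le_of_norm_le hMi (ae_of_all _ fun t => ?_)).trans (le_of_eq ?_)
    · rw [norm_smul, LinearIsometry.norm_map, partialDeriv, ncFourier_multiplier hg, ← hf]
      gcongr
      have e2 : phase (h • EuclideanSpace.single j (1 : ℝ)) t * f t - f t
          - h • (Complex.I * (t j : ℂ) * f t)
          = (Complex.exp (Complex.I * (h * t j : ℝ)) - 1 - Complex.I * (h * t j : ℝ)) * f t := by
        rw [phase, hin, Complex.real_smul]
        push_cast
        ring
      rw [e2, norm_mul, ← mul_assoc]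
      gcongr
      refine (norm_exp_sub_le _).trans ?_
      have h1 : |t j| ≤ ‖t‖ := by
        simpa using PiLp.norm_apply_le t j
      have h2 : t j ^ 2 ≤ ‖t‖ ^ 2 := by
        rw [← sq_abs]; gcongr
      rw [mul_pow, ← mul_assoc]
      gcongr
    · rw [integral_mul_const, integral_const_mul, ← hM]
      ring
  have h0 : translate ((0 : ℝ) • EuclideanSpace.single j (1 : ℝ)) x.op = x.op := by
    have := key 0
    rw [zero_smul, zero_smul, sub_zero] at this
    have h2 := norm_le_zero_iff.1 (this.trans (by simp))
    rw [zero_smul]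
    exact sub_eq_zero.1 h2
  rw [hasDerivAt_iff_isLittleO_nhds_zero]
  simp only [zero_add, h0]
  have hO : (fun h : ℝ => translate (h • EuclideanSpace.single j (1 : ℝ)) x.op - x.op
      - h • (partialDeriv θ j x).op) =O[𝓝 0] fun h : ℝ => h ^ 2 :=
    Asymptotics.IsBigO.of_bound (3 * M) (Eventually.of_forall fun h => by
      rw [Real.norm_of_nonneg (sq_nonneg h)]
      exact key h)
  exact hO.trans_isLittleO (by
    simpa using Asymptotics.isLittleO_pow_id (𝕜 := ℝ) (n := 2) (by norm_num))

/-- The Laplace operator `∂_1² + ⋯ + ∂_d²` on `𝒮(ℝ^d_θ)`. -/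
def laplacian (θ : SkewMatrix d) : NCSchwartz θ →L[ℂ] NCSchwartz θ :=
  ∑ j, partialDeriv θ j ∘L partialDeriv θ j

/-- The Laplace operator on `𝒮'(ℝ^d_θ)`, by duality. -/
def laplacianDual (θ : SkewMatrix d) (u : NCDual θ) : NCDual θ := u ∘L laplacian θ

/-- The symbol `ξ ↦ (1 + |ξ|²)^{γ/2}`. -/
def besselSymbol (γ : ℝ) (ξ : Space d) : ℂ := (((1 + ‖ξ‖ ^ 2) ^ (γ / 2) : ℝ) : ℂ)

/-- The operator `(1 - Δ_θ)^{γ/2}` on `𝒮'(ℝ^d_θ)`, by duality. -/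
def bessel (θ : SkewMatrix d) (γ : ℝ) (u : NCDual θ) : NCDual θ :=
  u ∘L multiplier θ (besselSymbol γ)

/-- `u ∈ H^γ(ℝ^d_θ)`, that is `(1 - Δ_θ)^{γ/2} u ∈ L²(ℝ^d_θ)`. -/
def MemSobolev (θ : SkewMatrix d) (γ : ℝ) (u : NCDual θ) : Prop :=
  ∃ v : NCL2 θ, ∀ y, bessel θ γ u y = l2Pairing θ v y

/-- The norm `‖u‖_{H^γ} = ‖(1 - Δ_θ)^{γ/2} u‖_{L²}`; it is `∞` if `u ∉ H^γ(ℝ^d_θ)`. -/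
def sobolevNorm (θ : SkewMatrix d) (γ : ℝ) (u : NCDual θ) : ℝ≥0∞ :=
  ⨅ (v : NCL2 θ) (_ : ∀ y, bessel θ γ u y = l2Pairing θ v y), ‖v‖ₑ

/-- `v` is the derivative of `x` at `t` within `S`, with respect to the norm of `H^γ`. -/
def HasSobolevDerivWithinAt (θ : SkewMatrix d) (γ : ℝ) (x : ℝ → NCDual θ) (v : NCDual θ)
    (S : Set ℝ) (t : ℝ) : Prop :=
  Tendsto (fun r : ℝ => sobolevNorm θ γ ((((r - t)⁻¹ : ℝ) : ℂ) • (x r - x t) - v))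
    (𝓝[S \ {t}] t) (𝓝 0)

/-- `x : [0, ∞) → 𝒮'(ℝ^d_θ)` solves `∂_t² x - Δ_θ x + b ∂_t x + m x = 0` for `t > 0` with
`x(0) = x₀` and `∂_t x(0) = x₁`: for some order `r`, `x` is continuously differentiable on
`[0, ∞)` with values in `H^r` and twice differentiable on `(0, ∞)`, time derivatives being
taken in the norm of `H^r`. The values at negative times are irrelevant. -/
def IsDampedWaveSolution (θ : SkewMatrix d) (b m : ℝ) (x₀ x₁ : NCDual θ)
    (x : ℝ → NCDual θ) : Prop :=
  ∃ (r : ℝ) (v w : ℝ → NCDual θ),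
    x 0 = x₀ ∧ v 0 = x₁ ∧
    (∀ t, 0 ≤ t → MemSobolev θ r (x t) ∧ MemSobolev θ r (v t)) ∧
    (∀ t, 0 ≤ t → HasSobolevDerivWithinAt θ r x (v t) (Set.Ici 0) t) ∧
    Tendsto (fun t => sobolevNorm θ r (v t - v 0)) (𝓝[>] 0) (𝓝 0) ∧
    (∀ t, 0 < t → HasSobolevDerivWithinAt θ r v (w t) (Set.Ioi 0) t) ∧
    ∀ t, 0 < t → w t - laplacianDual θ (x t) + (b : ℂ) • v t + (m : ℂ) • x t = 0

/-- `D 0 = x, D 1, …, D n` are the successive time derivatives of `x` on `(0, ∞)`, taken in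
the norm of `H^γ`. -/
def IsIteratedTimeDeriv (θ : SkewMatrix d) (γ : ℝ) (n : ℕ) (x : ℝ → NCDual θ)
    (D : ℕ → ℝ → NCDual θ) : Prop :=
  D 0 = x ∧ ∀ j < n, ∀ t, 0 < t → HasSobolevDerivWithinAt θ γ (D j) (D (j + 1) t) (Set.Ioi 0) t

end NCEuclidean

end

noncomputable section

namespace NCEuclidean

variable {d : ℕ} {θ : SkewMatrix d}

/-! ### Fourier representation of the Sobolev spaces -/

/-! The Fourier transform `λ_θ⁻¹` removes the noncommutativity. The trace evaluates the twisted
convolution at the origin, where its phase is 1, so `τ_θ(xy) = ∫ x̂(ξ) ŷ(-ξ) dξ` and `L²(ℝ^d_θ)` is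
isometric to `L²(ℝ^d)`, whatever θ is. Hence `u ∈ H^γ` means `u(y) = ∫ f(ξ) ŷ(-ξ) dξ` with
`(1+|ξ|²)^{γ/2} f ∈ L²`. This is `Represents`, with `memSobolev_iff` and
`Represents.sobolevNorm_eq`; the Laplacian becomes multiplication of `f` by `-|ξ|²`.

The equation thus decouples into the scalar oscillators `u'' + b u' + (|ξ|²+m) u = 0`. Their
stiffness `κ = |ξ|²+m` is at least `m > 0`, so a Lyapunov functional, the energy plus a small
multiple of `⟨u, u'⟩`, decays at a rate independent of `ξ` (`damped_energy_decay`). With `μ =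
(1+|ξ|²)^{1/2}` the energy is comparable to `(μ|u|)² + |u'|²`, which is why `x₁` has one order less
than `x₀`. The equation expresses each higher derivative through the two before it, at a cost of one
factor `μ` per time derivative (`exists_oscDeriv_bound`). Multiplying by a power of `μ` and taking
`L²` norms gives the estimates for every `s` at once.

Two facts link the scalar solutions to the Cauchy problem. For existence, the bounds are uniform in
`t ≥ 0`, so dominated convergence turns pointwise derivatives into derivatives in Sobolev norm
(`hasSobolevDerivWithinAt_of_dominated`). For uniqueness, two arbitrary solutions are compared in
the weaker of their two spaces `H^r`, by an energy weighted so that it is finite there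
(`dampedWave_eq_zero`). Every solution therefore coincides with the explicit one for `t ≥ 0` and
inherits its bounds. -/

theorem besselSymbol_add (γ γ' : ℝ) (ξ : Space d) :
    besselSymbol (γ + γ') ξ = besselSymbol γ ξ * besselSymbol γ' ξ := by
  have h : (0 : ℝ) < 1 + ‖ξ‖ ^ 2 := by positivity
  rw [besselSymbol, add_div, Real.rpow_add h]
  push_cast
  rfl

theorem besselSymbol_zero (ξ : Space d) : besselSymbol 0 ξ = 1 := by simp [besselSymbol]

theorem besselSymbol_two (ξ : Space d) : besselSymbol 2 ξ = ((1 + ‖ξ‖ ^ 2 : ℝ) : ℂ) := by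
  simp [besselSymbol]

theorem besselSymbol_neg (γ : ℝ) (ξ : Space d) : besselSymbol γ (-ξ) = besselSymbol γ ξ := by
  simp [besselSymbol]

theorem besselSymbol_mul_neg (γ : ℝ) (ξ : Space d) :
    besselSymbol γ ξ * besselSymbol (-γ) ξ = 1 := by
  rw [← besselSymbol_add, add_neg_cancel, besselSymbol_zero]

theorem besselSymbol_ne_zero (γ : ℝ) (ξ : Space d) : besselSymbol γ ξ ≠ 0 :=
  left_ne_zero_of_mul_eq_one (besselSymbol_mul_neg γ ξ)

theorem norm_besselSymbol (γ : ℝ) (ξ : Space d) :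
    ‖besselSymbol γ ξ‖ = (1 + ‖ξ‖ ^ 2) ^ (γ / 2) := by
  have h : (0 : ℝ) < 1 + ‖ξ‖ ^ 2 := by positivity
  rw [besselSymbol, Complex.norm_real, Real.norm_of_nonneg (by positivity)]

theorem norm_besselSymbol_mono {γ γ' : ℝ} (h : γ ≤ γ') (ξ : Space d) :
    ‖besselSymbol γ ξ‖ ≤ ‖besselSymbol γ' ξ‖ := by
  rw [norm_besselSymbol, norm_besselSymbol]
  exact Real.rpow_le_rpow_of_exponent_le (by nlinarith [sq_nonneg ‖ξ‖]) (by linarith)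

theorem continuous_besselSymbol (γ : ℝ) : Continuous (besselSymbol γ : Space d → ℂ) := by
  unfold besselSymbol
  refine Complex.continuous_ofReal.comp (Continuous.rpow_const (by fun_prop) fun ξ => Or.inl ?_)
  positivity

theorem hasTemperateGrowth_besselSymbol (γ : ℝ) :
    (besselSymbol γ : Space d → ℂ).HasTemperateGrowth := by
  have h := Complex.ofRealCLM.hasTemperateGrowth.comp
    (Function.hasTemperateGrowth_one_add_norm_sq_rpow (Space d) (γ / 2))
  exact h

/-- The reflected Fourier transform `y ↦ (ξ ↦ ŷ(-ξ))`. -/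
def reflFourier (θ : SkewMatrix d) : NCSchwartz θ →L[ℂ] 𝓢(Space d, ℂ) :=
  SchwartzMap.compCLMOfContinuousLinearEquiv ℂ
    (LinearIsometryEquiv.neg ℝ (E := Space d)).toContinuousLinearEquiv
    ∘L (ncFourier θ).toContinuousLinearMap

theorem reflFourier_apply (y : NCSchwartz θ) (ξ : Space d) :
    reflFourier θ y ξ = ncFourier θ y (-ξ) := rfl

/-- Makes every Schwartz function, in particular every bump function, available as a test function
on the Fourier side. -/
theorem reflFourier_surjective (θ : SkewMatrix d) : Function.Surjective (reflFourier θ) := by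
  intro φ
  refine ⟨(ncFourier θ).symm (SchwartzMap.compCLMOfContinuousLinearEquiv ℂ
    (LinearIsometryEquiv.neg ℝ (E := Space d)).toContinuousLinearEquiv φ), ?_⟩
  ext ξ
  rw [reflFourier_apply, ContinuousLinearEquiv.apply_symm_apply]
  simp

theorem reflFourier_multiplier_besselSymbol (γ : ℝ) (y : NCSchwartz θ) (ξ : Space d) :
    reflFourier θ (multiplier θ (besselSymbol γ) y) ξ = besselSymbol γ ξ * reflFourier θ y ξ := by
  rw [reflFourier_apply, ncFourier_multiplier (hasTemperateGrowth_besselSymbol γ),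
    besselSymbol_neg, reflFourier_apply]

theorem reflFourier_laplacian (y : NCSchwartz θ) (ξ : Space d) :
    reflFourier θ (laplacian θ y) ξ = -((‖ξ‖ ^ 2 : ℝ) : ℂ) * reflFourier θ y ξ := by
  rw [reflFourier_apply, reflFourier_apply, laplacian]
  simp only [sum_apply, map_sum]
  have h : ∀ j : Fin d, ncFourier θ ((partialDeriv θ j ∘L partialDeriv θ j) y) (-ξ)
      = -((ξ j ^ 2 : ℝ) : ℂ) * ncFourier θ y (-ξ) := by
    intro j
    rw [ContinuousLinearMap.comp_apply, partialDeriv,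
      ncFourier_multiplier (hasTemperateGrowth_coord j),
      ncFourier_multiplier (hasTemperateGrowth_coord j)]
    simp only [PiLp.neg_apply]
    push_cast
    linear_combination (ξ j : ℂ) ^ 2 * ncFourier θ y (-ξ) * Complex.I_sq
  simp only [h]
  rw [← Finset.sum_mul, EuclideanSpace.norm_sq_eq]
  simp

/-- `L²(ℝ^d_θ)` is isometric to `L²(ℝ^d)` by the Fourier transform. -/
def l2Fourier (θ : SkewMatrix d) : NCL2 θ ≃ₗᵢ[ℂ] Hilb d :=
  (PreL2.toSchwartz.trans (ncFourier θ).toLinearEquiv).extendOfIsometry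
    (UniformSpace.Completion.toComplₗᵢ (𝕜 := ℂ) (E := PreL2 θ)).toLinearMap
    (SchwartzMap.toLpCLM ℂ ℂ 2 (volume : Measure (Space d))).toLinearMap
    UniformSpace.Completion.denseRange_coe
    (SchwartzMap.denseRange_toLpCLM (by norm_num)) (fun x => by
      change ‖(ncFourier θ x.toSchwartz).toLp 2 volume‖ = ‖(x : NCL2 θ)‖
      rw [UniformSpace.Completion.norm_coe, norm_preL2,
        SchwartzMap.norm_toLp' (by norm_num) (by norm_num), Real.sqrt_eq_rpow]
      simp)

theorem l2Fourier_coe (x : PreL2 θ) :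
    l2Fourier θ (x : NCL2 θ) = (ncFourier θ x.toSchwartz).toLp 2 volume :=
  LinearEquiv.extendOfIsometry_eq (PreL2.toSchwartz.trans (ncFourier θ).toLinearEquiv)
    (UniformSpace.Completion.toComplₗᵢ (𝕜 := ℂ) (E := PreL2 θ)).toLinearMap
    (SchwartzMap.toLpCLM ℂ ℂ 2 (volume : Measure (Space d))).toLinearMap _ _ _ x

/-- On `𝒮(ℝ^d_θ)` this is the trace formula `ncTrace_mul`; both sides are continuous in `v`, so
density finishes. The right side is read as a tempered distribution only to obtain that continuity.
-/
theorem l2Pairing_eq (v : NCL2 θ) (y : NCSchwartz θ) :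
    l2Pairing θ v y = ∫ ξ, l2Fourier θ v ξ * reflFourier θ y ξ := by
  have hint : ∀ G : Hilb d, ∫ ξ, G ξ * reflFourier θ y ξ
      = Lp.toTemperedDistributionCLM ℂ volume 2 G (reflFourier θ y) := by
    intro G
    rw [Lp.toTemperedDistributionCLM_apply, Lp.toTemperedDistribution_apply]
    simp only [smul_eq_mul, mul_comm]
  rw [hint]
  induction v using UniformSpace.Completion.induction_on with
  | hp =>
    refine isClosed_eq UniformSpace.Completion.continuous_extension ?_
    have := (PointwiseConvergenceCLM.evalCLM (RingHom.id ℂ) ℂ (reflFourier θ y)).continuous.comp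
      ((Lp.toTemperedDistributionCLM ℂ (volume : Measure (Space d)) 2).continuous.comp
        (l2Fourier θ).continuous)
    exact this
  | ih x =>
    rw [l2Pairing_coe, ncTrace_mul, ← hint, l2Fourier_coe]
    refine integral_congr_ae ?_
    filter_upwards [(ncFourier θ x.toSchwartz).coeFn_toLp 2 volume] with ξ hξ
    rw [hξ, reflFourier_apply]

/-- `u ∈ H^γ(ℝ^d_θ)` has the Fourier transform `f`. -/
def Represents (θ : SkewMatrix d) (γ : ℝ) (f : Space d → ℂ) (u : NCDual θ) : Prop :=
  MemLp (fun ξ => besselSymbol γ ξ * f ξ) 2 ∧ ∀ y, u y = ∫ ξ, f ξ * reflFourier θ y ξ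

theorem aestronglyMeasurable_of_besselSymbol_mul {γ : ℝ} {f : Space d → ℂ}
    (h : AEStronglyMeasurable (fun ξ => besselSymbol γ ξ * f ξ)) :
    AEStronglyMeasurable f := by
  refine ((continuous_besselSymbol (-γ)).aestronglyMeasurable.mul h).congr
    (ae_of_all _ fun ξ => ?_)
  change besselSymbol (-γ) ξ * (besselSymbol γ ξ * f ξ) = f ξ
  linear_combination f ξ * besselSymbol_mul_neg γ ξ

theorem MemLp.besselSymbol_mono {γ γ' : ℝ} (h : γ ≤ γ') {f : Space d → ℂ}
    (hf : MemLp (fun ξ => besselSymbol γ' ξ * f ξ) 2) :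
    MemLp (fun ξ => besselSymbol γ ξ * f ξ) 2 := by
  refine hf.of_le ((continuous_besselSymbol γ).aestronglyMeasurable.mul
    (aestronglyMeasurable_of_besselSymbol_mul hf.1)) (ae_of_all _ fun ξ => ?_)
  rw [norm_mul, norm_mul]
  gcongr
  exact norm_besselSymbol_mono h ξ

/-- Moving the weight to the test function writes the integrand as a product of two `L²` functions.
-/
theorem integrable_mul_reflFourier {γ : ℝ} {f : Space d → ℂ}
    (hf : MemLp (fun ξ => besselSymbol γ ξ * f ξ) 2) (y : NCSchwartz θ) :
    Integrable fun ξ => f ξ * reflFourier θ y ξ := by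
  refine (hf.integrable_mul ((reflFourier θ (multiplier θ (besselSymbol (-γ)) y)).memLp 2
    volume)).congr (ae_of_all _ fun ξ => ?_)
  simp only [Pi.mul_apply, reflFourier_multiplier_besselSymbol]
  linear_combination f ξ * reflFourier θ y ξ * besselSymbol_mul_neg γ ξ

theorem Represents.bessel_apply {γ : ℝ} {f : Space d → ℂ} {u : NCDual θ}
    (h : Represents θ γ f u) (y : NCSchwartz θ) :
    bessel θ γ u y = ∫ ξ, besselSymbol γ ξ * f ξ * reflFourier θ y ξ := by
  change u (multiplier θ (besselSymbol γ) y) = _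
  rw [h.2]
  refine integral_congr_ae (ae_of_all _ fun ξ => ?_)
  simp only [reflFourier_multiplier_besselSymbol]
  ring

/-- The fundamental lemma of the calculus of variations, since the functions `reflFourier θ y`
include all smooth compactly supported ones. -/
theorem ae_eq_of_forall_integral_reflFourier {f g : Space d → ℂ} (hf : LocallyIntegrable f)
    (hg : LocallyIntegrable g) (hfi : ∀ y, Integrable fun ξ => f ξ * reflFourier θ y ξ)
    (hgi : ∀ y, Integrable fun ξ => g ξ * reflFourier θ y ξ)
    (h : ∀ y, ∫ ξ, f ξ * reflFourier θ y ξ = ∫ ξ, g ξ * reflFourier θ y ξ) : f =ᵐ[volume] g := by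
  have h0 : ∀ᵐ ξ ∂volume, (f - g) ξ = 0 := by
    refine ae_eq_zero_of_integral_contDiff_smul_eq_zero (hf.sub hg) fun φ hφ hφc => ?_
    have hφ₁ : HasCompactSupport (Complex.ofRealCLM ∘ φ) := hφc.comp_left rfl
    have hφ₂ : ContDiff ℝ ((⊤ : ℕ∞) : WithTop ℕ∞) (Complex.ofRealCLM ∘ φ) := by fun_prop
    obtain ⟨y, hy⟩ := reflFourier_surjective θ (hφ₁.toSchwartzMap hφ₂)
    have hy' : ∀ ξ, reflFourier θ y ξ = φ ξ := fun ξ => by rw [hy]; rfl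
    have h1 := sub_eq_zero.2 (h y)
    rw [← integral_sub (hfi y) (hgi y)] at h1
    rw [← h1]
    refine integral_congr_ae (ae_of_all _ fun ξ => ?_)
    simp only [hy', Pi.sub_apply, Complex.real_smul]
    ring
  filter_upwards [h0] with ξ hξ
  exact sub_eq_zero.1 hξ

theorem locallyIntegrable_of_besselSymbol_mul {γ : ℝ} {f : Space d → ℂ}
    (hf : MemLp (fun ξ => besselSymbol γ ξ * f ξ) 2) : LocallyIntegrable f := by
  have h := (hf.locallyIntegrable (by norm_num)).smul_continuous (continuous_besselSymbol (-γ))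
  refine h.congr (ae_of_all _ fun ξ => ?_)
  simp only [smul_eq_mul]
  linear_combination f ξ * besselSymbol_mul_neg γ ξ

/-- The two orders may differ: the Fourier transform belongs to the functional, not to the Sobolev
space in which it is viewed. -/
theorem Represents.ae_eq {γ γ' : ℝ} {f g : Space d → ℂ} {u : NCDual θ}
    (hf : Represents θ γ f u) (hg : Represents θ γ' g u) : f =ᵐ[volume] g :=
  ae_eq_of_forall_integral_reflFourier (locallyIntegrable_of_besselSymbol_mul hf.1)
    (locallyIntegrable_of_besselSymbol_mul hg.1) (integrable_mul_reflFourier hf.1)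
    (integrable_mul_reflFourier hg.1) fun y => by rw [← hf.2, ← hg.2]

theorem Represents.ext {γ γ' : ℝ} {f g : Space d → ℂ} {u v : NCDual θ}
    (hf : Represents θ γ f u) (hg : Represents θ γ' g v) (h : f =ᵐ[volume] g) : u = v := by
  ext y
  rw [hf.2, hg.2]
  refine integral_congr_ae ?_
  filter_upwards [h] with ξ hξ
  rw [hξ]

theorem memSobolev_iff {γ : ℝ} {u : NCDual θ} :
    MemSobolev θ γ u ↔ ∃ f, Represents θ γ f u := by
  constructor
  · rintro ⟨v, hv⟩
    -- The transform of `u` is that of `v = (1-Δ_θ)^{γ/2} u` divided by the symbol.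
    have hm : MemLp (fun ξ => besselSymbol γ ξ * (besselSymbol (-γ) ξ * l2Fourier θ v ξ)) 2 := by
      refine (Lp.memLp (l2Fourier θ v)).ae_eq (ae_of_all _ fun ξ => ?_)
      linear_combination -(l2Fourier θ v ξ) * besselSymbol_mul_neg γ ξ
    refine ⟨fun ξ => besselSymbol (-γ) ξ * l2Fourier θ v ξ, hm, fun y => ?_⟩
    have h1 : multiplier θ (besselSymbol γ) (multiplier θ (besselSymbol (-γ)) y) = y := by
      apply (ncFourier θ).injective
      ext ξ
      rw [ncFourier_multiplier (hasTemperateGrowth_besselSymbol γ),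
        ncFourier_multiplier (hasTemperateGrowth_besselSymbol (-γ)), ← mul_assoc,
        besselSymbol_mul_neg, one_mul]
    have h2 := hv (multiplier θ (besselSymbol (-γ)) y)
    change u (multiplier θ (besselSymbol γ) (multiplier θ (besselSymbol (-γ)) y)) = _ at h2
    rw [h1] at h2
    rw [h2, l2Pairing_eq]
    refine integral_congr_ae (ae_of_all _ fun ξ => ?_)
    simp only [reflFourier_multiplier_besselSymbol]
    ring
  · rintro ⟨f, hf⟩
    refine ⟨(l2Fourier θ).symm hf.1.toLp, fun y => ?_⟩
    rw [hf.bessel_apply, l2Pairing_eq, LinearIsometryEquiv.apply_symm_apply]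
    refine integral_congr_ae ?_
    filter_upwards [hf.1.coeFn_toLp] with ξ hξ
    rw [hξ]

/-- The infimum defining `sobolevNorm` runs over a single `v`, because an element of `L²(ℝ^d_θ)` is
determined by its pairings; `l2Fourier` preserves its norm. -/
theorem Represents.sobolevNorm_eq {γ : ℝ} {f : Space d → ℂ} {u : NCDual θ}
    (h : Represents θ γ f u) :
    sobolevNorm θ γ u = eLpNorm (fun ξ => besselSymbol γ ξ * f ξ) 2 volume := by
  have key : ∀ v : NCL2 θ, (∀ y, bessel θ γ u y = l2Pairing θ v y) ↔
      v = (l2Fourier θ).symm h.1.toLp := by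
    have h2 : ∀ G : Hilb d, MemLp (fun ξ => besselSymbol 0 ξ * G ξ) 2 := fun G =>
      (Lp.memLp G).ae_eq (ae_of_all _ fun ξ => by simp [besselSymbol_zero])
    have h3 : ∀ y, bessel θ γ u y = ∫ ξ, (h.1.toLp : Hilb d) ξ * reflFourier θ y ξ := by
      intro y
      rw [h.bessel_apply]
      refine integral_congr_ae ?_
      filter_upwards [h.1.coeFn_toLp] with ξ hξ
      rw [hξ]
    intro v
    simp only [h3, l2Pairing_eq]
    constructor
    · intro hv
      rw [LinearIsometryEquiv.eq_symm_apply]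
      exact Lp.ext (ae_eq_of_forall_integral_reflFourier
        (locallyIntegrable_of_besselSymbol_mul (h2 _))
        (locallyIntegrable_of_besselSymbol_mul (h2 _)) (integrable_mul_reflFourier (h2 _))
        (integrable_mul_reflFourier (h2 _)) fun y => (hv y).symm)
    · rintro rfl y
      rw [LinearIsometryEquiv.apply_symm_apply]
  unfold sobolevNorm
  simp only [key, iInf_iInf_eq_left]
  rw [← Lp.enorm_toLp h.1]
  rw [← ofReal_norm, ← ofReal_norm, LinearIsometryEquiv.norm_map]

theorem sobolevNorm_eq_top {γ : ℝ} {u : NCDual θ} (h : ¬ MemSobolev θ γ u) :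
    sobolevNorm θ γ u = ∞ := by
  unfold sobolevNorm
  simp only [iInf_eq_top]
  intro v hv
  exact absurd ⟨v, hv⟩ h

/-- The integral against `f` is a continuous functional because it is the `L²` functional of the
weighted function, precomposed with the multiplier of order `-γ`. -/
theorem exists_represents (θ : SkewMatrix d) {γ : ℝ} {f : Space d → ℂ}
    (hf : MemLp (fun ξ => besselSymbol γ ξ * f ξ) 2) : ∃ u, Represents θ γ f u := by
  let T : 𝓢(Space d, ℂ) →L[ℂ] ℂ :=
    ⟨(Lp.toTemperedDistribution hf.toLp).toLinearMap, (Lp.toTemperedDistribution hf.toLp).cont⟩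
  refine ⟨T ∘L reflFourier θ ∘L multiplier θ (besselSymbol (-γ)), hf, fun y => ?_⟩
  change Lp.toTemperedDistribution hf.toLp _ = _
  rw [Lp.toTemperedDistribution_apply]
  refine integral_congr_ae ?_
  filter_upwards [hf.coeFn_toLp] with ξ hξ
  change reflFourier θ (multiplier θ (besselSymbol (-γ)) y) ξ • _ = _
  rw [hξ, reflFourier_multiplier_besselSymbol, smul_eq_mul]
  linear_combination f ξ * reflFourier θ y ξ * besselSymbol_mul_neg γ ξ

/-! ### Linear operations, the Laplacian and change of order -/

theorem Represents.mono {γ γ' : ℝ} (h : γ ≤ γ') {f : Space d → ℂ} {u : NCDual θ}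
    (hf : Represents θ γ' f u) : Represents θ γ f u :=
  ⟨MemLp.besselSymbol_mono h hf.1, hf.2⟩

theorem Represents.add {γ : ℝ} {f g : Space d → ℂ} {u v : NCDual θ}
    (hf : Represents θ γ f u) (hg : Represents θ γ g v) :
    Represents θ γ (fun ξ => f ξ + g ξ) (u + v) := by
  refine ⟨(hf.1.add hg.1).ae_eq (ae_of_all _ fun ξ => by simp [mul_add]), fun y => ?_⟩
  rw [add_apply, hf.2, hg.2, ← integral_add (integrable_mul_reflFourier hf.1 y)
    (integrable_mul_reflFourier hg.1 y)]
  simp only [add_mul]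

theorem Represents.smul {γ : ℝ} {f : Space d → ℂ} {u : NCDual θ} (c : ℂ)
    (hf : Represents θ γ f u) : Represents θ γ (fun ξ => c * f ξ) (c • u) := by
  refine ⟨(hf.1.const_mul c).ae_eq (ae_of_all _ fun ξ => by simp; ring), fun y => ?_⟩
  rw [smul_apply, hf.2, smul_eq_mul, ← integral_const_mul]
  simp only [mul_assoc]

theorem Represents.sub {γ : ℝ} {f g : Space d → ℂ} {u v : NCDual θ}
    (hf : Represents θ γ f u) (hg : Represents θ γ g v) :
    Represents θ γ (fun ξ => f ξ - g ξ) (u - v) := by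
  have h := hf.add (hg.smul (-1))
  rw [neg_one_smul ℂ v, ← sub_eq_add_neg] at h
  simpa only [neg_one_mul, ← sub_eq_add_neg] using h

theorem represents_zero (γ : ℝ) : Represents θ γ (fun _ => 0) (0 : NCDual θ) :=
  ⟨by simp, fun y => by simp⟩

theorem Represents.laplacian {γ : ℝ} {f : Space d → ℂ} {u : NCDual θ}
    (hf : Represents θ γ f u) :
    Represents θ (γ - 2) (fun ξ => -((‖ξ‖ ^ 2 : ℝ) : ℂ) * f ξ) (laplacianDual θ u) := by
  refine ⟨hf.1.of_le ?_ (ae_of_all _ fun ξ => ?_), fun y => ?_⟩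
  · refine (continuous_besselSymbol _).aestronglyMeasurable.mul
      (AEStronglyMeasurable.mul (Continuous.aestronglyMeasurable (by fun_prop))
        (aestronglyMeasurable_of_besselSymbol_mul hf.1.1))
  -- The loss of two orders pays for `|ξ|² ≤ 1 + |ξ|²`.
  · have h := besselSymbol_add (γ - 2) 2 ξ
    rw [sub_add_cancel] at h
    rw [h, besselSymbol_two]
    simp only [norm_mul, norm_neg, Complex.norm_real]
    rw [mul_assoc]
    gcongr
    rw [Real.norm_of_nonneg (by positivity), Real.norm_of_nonneg (by positivity)]
    linarith
  · change u (NCEuclidean.laplacian θ y) = _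
    rw [hf.2]
    refine integral_congr_ae (ae_of_all _ fun ξ => ?_)
    simp only [reflFourier_laplacian]
    ring

theorem sobolevNorm_mono {γ γ' : ℝ} (h : γ ≤ γ') (u : NCDual θ) :
    sobolevNorm θ γ u ≤ sobolevNorm θ γ' u := by
  by_cases hu : MemSobolev θ γ' u
  · obtain ⟨f, hf⟩ := memSobolev_iff.1 hu
    rw [hf.sobolevNorm_eq, (hf.mono h).sobolevNorm_eq]
    refine eLpNorm_mono fun ξ => ?_
    rw [norm_mul, norm_mul]
    gcongr
    exact norm_besselSymbol_mono h ξ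
  · rw [sobolevNorm_eq_top hu]
    exact le_top

theorem MemSobolev.mono {γ γ' : ℝ} (h : γ ≤ γ') {u : NCDual θ} (hu : MemSobolev θ γ' u) :
    MemSobolev θ γ u := by
  obtain ⟨f, hf⟩ := memSobolev_iff.1 hu
  exact memSobolev_iff.2 ⟨f, hf.mono h⟩

theorem HasSobolevDerivWithinAt.mono_order {γ γ' : ℝ} (h : γ ≤ γ') {x : ℝ → NCDual θ}
    {v : NCDual θ} {S : Set ℝ} {t : ℝ} (hx : HasSobolevDerivWithinAt θ γ' x v S t) :
    HasSobolevDerivWithinAt θ γ x v S t :=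
  tendsto_of_tendsto_of_tendsto_of_le_of_le tendsto_const_nhds hx (fun _ => zero_le)
    fun _ => sobolevNorm_mono h _

/-! ### The damped oscillator -/

/-- The energy alone dissipates only through `V`. Adding `2ε⟨U, V⟩` yields dissipation of `κ‖U‖²` as
well. By `h1` the added term is at most half the energy, so the modified energy lies between 1/2 and
3/2 of it, whence the factor 3; by `h2` the velocity terms it creates are absorbed by the damping.
The constraints on `ε` involve only `b` and the lower bound `c` of `κ`. -/
theorem damped_energy_decay {F : Type*} [NormedAddCommGroup F] [InnerProductSpace ℝ F]
    {b c ε κ : ℝ} (hb : 0 < b) (hc : 0 < c) (hε : 0 < ε) (h1 : 4 * ε ^ 2 ≤ c)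
    (h2 : ε * (2 + b ^ 2 / c) ≤ b) (hκ : c ≤ κ) {U V : ℝ → F}
    (hU : ∀ t, HasDerivAt U (V t) t) (hV : ∀ t, HasDerivAt V (-(b • V t) - κ • U t) t)
    {t : ℝ} (ht : 0 ≤ t) :
    ‖V t‖ ^ 2 + κ * ‖U t‖ ^ 2
      ≤ 3 * Real.exp (-(ε / 3) * t) ^ 2 * (‖V 0‖ ^ 2 + κ * ‖U 0‖ ^ 2) := by
  set E : ℝ → ℝ := fun t => ‖V t‖ ^ 2 + κ * ‖U t‖ ^ 2 + 2 * ε * inner ℝ (U t) (V t) with hE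
  have hcross : ∀ t, |2 * ε * inner ℝ (U t) (V t)| ≤ (‖V t‖ ^ 2 + κ * ‖U t‖ ^ 2) / 2 := by
    intro t
    have h3 := abs_real_inner_le_norm (U t) (V t)
    rw [abs_mul, abs_of_pos (by positivity)]
    have h4 : 2 * ε * |inner ℝ (U t) (V t)| ≤ 2 * ε * (‖U t‖ * ‖V t‖) := by gcongr
    have h5 : 4 * ε ^ 2 * ‖U t‖ ^ 2 ≤ κ * ‖U t‖ ^ 2 := by gcongr; linarith
    nlinarith [sq_nonneg (‖V t‖ - 2 * ε * ‖U t‖)]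
  have hE' : ∀ t, HasDerivAt E (2 * inner ℝ (V t) (-(b • V t) - κ • U t)
      + κ * (2 * inner ℝ (U t) (V t))
      + 2 * ε * (inner ℝ (U t) (-(b • V t) - κ • U t) + inner ℝ (V t) (V t))) t := fun t =>
    ((hV t).norm_sq.add ((hU t).norm_sq.const_mul κ)).add
      (((hU t).inner ℝ (hV t)).const_mul (2 * ε))
  have hle : ∀ t, 2 * inner ℝ (V t) (-(b • V t) - κ • U t) + κ * (2 * inner ℝ (U t) (V t))
      + 2 * ε * (inner ℝ (U t) (-(b • V t) - κ • U t) + inner ℝ (V t) (V t))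
      ≤ -(2 * (ε / 3)) * E t := by
    intro t
    have h3 := (abs_le.1 (abs_real_inner_le_norm (U t) (V t))).1
    have h4 := (abs_le.1 (hcross t)).2
    simp only [hE, inner_sub_right, inner_neg_right, real_inner_smul_right,
      real_inner_self_eq_norm_sq, real_inner_comm (U t) (V t)]
    -- Young's inequality with weights `c` and `b²/c`; half of the dissipation `2εκ‖U‖²` absorbs the
    -- first term.
    have h5 : -(2 * b * inner ℝ (U t) (V t)) ≤ κ * ‖U t‖ ^ 2 + b ^ 2 / c * ‖V t‖ ^ 2 := by
      have h6 : 2 * b * (‖U t‖ * ‖V t‖) ≤ c * ‖U t‖ ^ 2 + b ^ 2 / c * ‖V t‖ ^ 2 := by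
        have h7 : 0 ≤ c * (‖U t‖ - b / c * ‖V t‖) ^ 2 := by positivity
        have h8 : c * (‖U t‖ - b / c * ‖V t‖) ^ 2
            = c * ‖U t‖ ^ 2 + b ^ 2 / c * ‖V t‖ ^ 2 - 2 * b * (‖U t‖ * ‖V t‖) := by
          field_simp
          ring
        linarith
      have h9 : c * ‖U t‖ ^ 2 ≤ κ * ‖U t‖ ^ 2 := by gcongr
      nlinarith
    have h10 : ε * (-(2 * b * inner ℝ (U t) (V t)))
        ≤ ε * (κ * ‖U t‖ ^ 2 + b ^ 2 / c * ‖V t‖ ^ 2) := by gcongr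
    have h11 : ε * (2 + b ^ 2 / c) * ‖V t‖ ^ 2 ≤ b * ‖V t‖ ^ 2 := by gcongr
    have h12 : ε ≤ b := by
      have : 0 ≤ ε * (b ^ 2 / c) := by positivity
      nlinarith
    have h13 : ε * ‖V t‖ ^ 2 ≤ b * ‖V t‖ ^ 2 := by gcongr
    nlinarith
  -- Grönwall with an integrating factor: the derivative is at most `-ε` times the energy, and `E`
  -- is at most 3/2 of the energy, hence the rate `2ε/3`.
  have hanti : AntitoneOn (fun t => Real.exp (2 * (ε / 3) * t) * E t) (Set.Ici 0) := by
    have hd : ∀ t, HasDerivAt (fun t => Real.exp (2 * (ε / 3) * t) * E t) _ t := fun t =>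
      ((((hasDerivAt_id t).const_mul (2 * (ε / 3))).exp).mul (hE' t))
    refine antitoneOn_of_deriv_nonpos (convex_Ici 0)
      (fun t _ => (hd t).continuousAt.continuousWithinAt)
      (fun t _ => (hd t).differentiableAt.differentiableWithinAt) fun t _ => ?_
    rw [(hd t).deriv]
    have h3 := mul_le_mul_of_nonneg_left (hle t) (Real.exp_pos (2 * (ε / 3) * id t)).le
    simp only [id] at h3 ⊢
    nlinarith
  have h3 := hanti Set.self_mem_Ici ht ht
  simp only [mul_zero, Real.exp_zero, one_mul] at h3
  have h4 : E t ≤ Real.exp (-(ε / 3) * t) ^ 2 * E 0 := by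
    have h5 : Real.exp (-(ε / 3) * t) ^ 2 * Real.exp (2 * (ε / 3) * t) = 1 := by
      rw [sq, ← Real.exp_add, ← Real.exp_add, ← Real.exp_zero]
      congr 1
      ring
    calc E t = Real.exp (-(ε / 3) * t) ^ 2 * (Real.exp (2 * (ε / 3) * t) * E t) := by
          rw [← mul_assoc, h5, one_mul]
      _ ≤ _ := by gcongr
  have h5 := (abs_le.1 (hcross t)).1
  have h6 := (abs_le.1 (hcross 0)).2
  have h7 : E 0 ≤ 3 / 2 * (‖V 0‖ ^ 2 + κ * ‖U 0‖ ^ 2) := by simp only [hE]; linarith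
  have h8 : (‖V t‖ ^ 2 + κ * ‖U t‖ ^ 2) / 2 ≤ E t := by simp only [hE]; linarith
  have h9 : Real.exp (-(ε / 3) * t) ^ 2 * E 0
    ≤ Real.exp (-(ε / 3) * t) ^ 2 * (3 / 2 * (‖V 0‖ ^ 2 + κ * ‖U 0‖ ^ 2)) := by gcongr
  linarith

/-- The generator `(u, v) ↦ (v, -b v - κ u)` of the damped oscillator. -/
def oscGenerator (b κ : ℝ) : (ℂ × ℂ) →L[ℝ] (ℂ × ℂ) :=
  (ContinuousLinearMap.inl ℝ ℂ ℂ - b • ContinuousLinearMap.inr ℝ ℂ ℂ) ∘L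
    ContinuousLinearMap.snd ℝ ℂ ℂ
    - κ • (ContinuousLinearMap.inr ℝ ℂ ℂ ∘L ContinuousLinearMap.fst ℝ ℂ ℂ)

/-- The flow of the damped oscillator. -/
def oscFlow (b κ t : ℝ) : (ℂ × ℂ) →L[ℝ] (ℂ × ℂ) := NormedSpace.exp (t • oscGenerator b κ)

theorem oscFlow_zero (b κ : ℝ) : oscFlow b κ 0 = 1 := by
  let _ : NormedAlgebra ℚ ((ℂ × ℂ) →L[ℝ] (ℂ × ℂ)) := NormedAlgebra.restrictScalars ℚ ℝ _
  rw [oscFlow, zero_smul ℝ (oscGenerator b κ), NormedSpace.exp_zero]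

/-- Gives measurability in `ξ` later; the exponential of the generator avoids splitting into
overdamped, critical and underdamped frequencies. -/
theorem continuous_oscFlow (b t : ℝ) : Continuous fun κ : ℝ => oscFlow b κ t := by
  have h : Continuous fun κ : ℝ => t • oscGenerator b κ := by
    unfold oscGenerator
    fun_prop
  let _ : NormedAlgebra ℚ ((ℂ × ℂ) →L[ℝ] (ℂ × ℂ)) := NormedAlgebra.restrictScalars ℚ ℝ _
  exact NormedSpace.exp_continuous.comp h

theorem hasDerivAt_oscFlow_apply (b κ : ℝ) (z : ℂ × ℂ) (t : ℝ) :
    HasDerivAt (fun t => oscFlow b κ t z) (oscGenerator b κ (oscFlow b κ t z)) t := by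
  have h := (hasDerivAt_exp_smul_const' (oscGenerator b κ) t).clm_apply (hasDerivAt_const t z)
  rw [map_zero, add_zero] at h
  exact h

/-- The time derivatives of the solution of `u'' + b u' + κ u = 0`, `u(0) = p`, `u'(0) = q`. -/
def oscDeriv (b κ : ℝ) (p q : ℂ) : ℕ → ℝ → ℂ
  | 0, t => (oscFlow b κ t (p, q)).1
  | 1, t => (oscFlow b κ t (p, q)).2
  | j + 2, t => -(b • oscDeriv b κ p q (j + 1) t) - κ • oscDeriv b κ p q j t

theorem oscDeriv_zero_zero (b κ : ℝ) (p q : ℂ) : oscDeriv b κ p q 0 0 = p := by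
  rw [oscDeriv, oscFlow_zero, one_apply_eq_self]

theorem oscDeriv_one_zero (b κ : ℝ) (p q : ℂ) : oscDeriv b κ p q 1 0 = q := by
  rw [oscDeriv, oscFlow_zero, one_apply_eq_self]

theorem hasDerivAt_oscDeriv (b κ : ℝ) (p q : ℂ) (j : ℕ) (t : ℝ) :
    HasDerivAt (oscDeriv b κ p q j) (oscDeriv b κ p q (j + 1) t) t := by
  have h0 := hasDerivAt_oscFlow_apply b κ (p, q) t
  induction j using Nat.twoStepInduction with
  | zero =>
    have h := (ContinuousLinearMap.fst ℝ ℂ ℂ).hasFDerivAt.comp_hasDerivAt t h0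
    convert! h using 1
    simp [oscDeriv, oscGenerator]
  | one =>
    have h := (ContinuousLinearMap.snd ℝ ℂ ℂ).hasFDerivAt.comp_hasDerivAt t h0
    convert! h using 1
    simp [oscDeriv, oscGenerator]
  | more j ih1 ih2 => exact (ih2.const_smul b).neg.sub (ih1.const_smul κ)

theorem aestronglyMeasurable_oscDeriv {X : Type*} [MeasurableSpace X] {μ : Measure X} (b : ℝ)
    {κ : X → ℝ} {p q : X → ℂ} (hκ : AEStronglyMeasurable κ μ) (hp : AEStronglyMeasurable p μ)
    (hq : AEStronglyMeasurable q μ) (j : ℕ) (t : ℝ) :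
    AEStronglyMeasurable (fun ξ => oscDeriv b (κ ξ) (p ξ) (q ξ) j t) μ := by
  have h0 : AEStronglyMeasurable (fun ξ => oscFlow b (κ ξ) t (p ξ, q ξ)) μ := by
    have hc : Continuous fun z : ℝ × (ℂ × ℂ) => oscFlow b z.1 t z.2 :=
      ((continuous_oscFlow b t).comp continuous_fst).clm_apply continuous_snd
    have hpq : AEStronglyMeasurable (fun ξ => (p ξ, q ξ)) μ := hp.prodMk hq
    have hm : AEStronglyMeasurable (fun ξ => (κ ξ, (p ξ, q ξ))) μ := hκ.prodMk hpq
    have h := Continuous.comp_aestronglyMeasurable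
      (g := fun z : ℝ × (ℂ × ℂ) => oscFlow b z.1 t z.2) hc hm
    exact h
  induction j using Nat.twoStepInduction with
  | zero => exact continuous_fst.comp_aestronglyMeasurable h0
  | one => exact continuous_snd.comp_aestronglyMeasurable h0
  | more j ih1 ih2 => exact (ih2.const_smul b).neg.sub (hκ.smul ih1)

/-- For `j = 0, 1` this is the energy decay, with `κ = μ² - 1 + m` between `c μ²` and `K μ²`. For
higher `j` the equation gives a factor `b` on the derivative before and `κ ≤ K μ²` on the one before
that, which matches the growth `μ ^ j`. The rate comes from `j = 0, 1` and never changes. -/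
theorem exists_oscDeriv_bound {b m : ℝ} (hb : 0 < b) (hm : 0 < m) :
    ∃ δ : ℝ, 0 < δ ∧ ∀ j : ℕ, ∃ C : ℝ, 0 < C ∧ ∀ (μ : ℝ), 1 ≤ μ → ∀ (p q : ℂ) (t : ℝ), 0 ≤ t →
      μ * ‖oscDeriv b (μ ^ 2 - 1 + m) p q j t‖
        ≤ C * Real.exp (-δ * t) * μ ^ j * (μ * ‖p‖ + ‖q‖) := by
  -- `c ≤ 1` gives `κ ≥ c(μ² - 1) + c = c μ²`, and `c ≤ m` gives the uniform bound `κ ≥ c`.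
  obtain ⟨c, hc, hc1, hcm⟩ : ∃ c : ℝ, 0 < c ∧ c ≤ 1 ∧ c ≤ m :=
    ⟨min 1 m, by positivity, min_le_left _ _, min_le_right _ _⟩
  obtain ⟨K, hK0, hK⟩ : ∃ K : ℝ, 0 < K ∧ ∀ μ : ℝ, 1 ≤ μ → μ ^ 2 - 1 + m ≤ K * μ ^ 2 :=
    ⟨1 + m, by positivity, fun μ hμ => by nlinarith [one_le_pow₀ hμ (n := 2)]⟩
  obtain ⟨ε, hε, h1, h2⟩ : ∃ ε : ℝ, 0 < ε ∧ 4 * ε ^ 2 ≤ c ∧ ε * (2 + b ^ 2 / c) ≤ b := by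
    -- The largest `ε` that meets both constraints.
    refine ⟨min (√c / 2) (b / (2 + b ^ 2 / c)), by positivity, ?_, ?_⟩
    · have h3 : min (√c / 2) (b / (2 + b ^ 2 / c)) ^ 2 ≤ (√c / 2) ^ 2 := by
        gcongr
        exact min_le_left _ _
      rw [div_pow, Real.sq_sqrt hc.le] at h3
      linarith
    · rw [← le_div_iff₀ (by positivity)]
      exact min_le_right _ _
  have hκ : ∀ μ : ℝ, 1 ≤ μ → c ≤ μ ^ 2 - 1 + m ∧ c * μ ^ 2 ≤ μ ^ 2 - 1 + m := fun μ hμ => by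
    have := one_le_pow₀ hμ (n := 2)
    constructor <;> nlinarith
  have hN : ∀ (μ : ℝ), 1 ≤ μ → ∀ (p q : ℂ) (t : ℝ), 0 ≤ t →
      ‖oscDeriv b (μ ^ 2 - 1 + m) p q 1 t‖ ^ 2
        + c * (μ * ‖oscDeriv b (μ ^ 2 - 1 + m) p q 0 t‖) ^ 2
        ≤ 3 * (1 + K) * (Real.exp (-(ε / 3) * t) * (μ * ‖p‖ + ‖q‖)) ^ 2 := by
    intro μ hμ p q t ht
    have h := damped_energy_decay hb hc hε h1 h2 (hκ μ hμ).1
      (hasDerivAt_oscDeriv b (μ ^ 2 - 1 + m) p q 0)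
      (hasDerivAt_oscDeriv b (μ ^ 2 - 1 + m) p q 1) ht
    rw [oscDeriv_zero_zero, oscDeriv_one_zero] at h
    have h3 : c * (μ * ‖oscDeriv b (μ ^ 2 - 1 + m) p q 0 t‖) ^ 2
        ≤ (μ ^ 2 - 1 + m) * ‖oscDeriv b (μ ^ 2 - 1 + m) p q 0 t‖ ^ 2 := by
      rw [mul_pow, ← mul_assoc]
      gcongr
      exact (hκ μ hμ).2
    have h4 : ‖q‖ ^ 2 + (μ ^ 2 - 1 + m) * ‖p‖ ^ 2 ≤ (1 + K) * (μ * ‖p‖ + ‖q‖) ^ 2 := by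
      have h5 : (μ ^ 2 - 1 + m) * ‖p‖ ^ 2 ≤ K * μ ^ 2 * ‖p‖ ^ 2 := by
        gcongr
        exact hK μ hμ
      have h6 : 0 ≤ μ * ‖p‖ * ‖q‖ := by positivity
      have h7 : 0 ≤ K * (μ * ‖p‖ * ‖q‖) := by positivity
      have h8 : 0 ≤ K * ‖q‖ ^ 2 := by positivity
      nlinarith [sq_nonneg (μ * ‖p‖)]
    refine (add_le_add_right h3 _).trans (h.trans ?_)
    have h5 := mul_le_mul_of_nonneg_left h4
      (by positivity : 0 ≤ 3 * Real.exp (-(ε / 3) * t) ^ 2)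
    refine h5.trans (le_of_eq (by ring))
  refine ⟨ε / 3, by positivity, fun j => ?_⟩
  induction j using Nat.twoStepInduction with
  | zero =>
    refine ⟨√(3 * (1 + K) / c), by positivity, fun μ hμ p q t ht => ?_⟩
    refine le_of_sq_le_sq ?_ (by positivity)
    rw [pow_zero, mul_one, mul_assoc, mul_pow √_, Real.sq_sqrt (by positivity), div_mul_eq_mul_div,
      le_div_iff₀ hc, mul_comm]
    exact (le_add_of_nonneg_left (by positivity)).trans (hN μ hμ p q t ht)
  | one =>
    refine ⟨√(3 * (1 + K)), by positivity, fun μ hμ p q t ht => ?_⟩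
    have h : ‖oscDeriv b (μ ^ 2 - 1 + m) p q 1 t‖
        ≤ √(3 * (1 + K)) * (Real.exp (-(ε / 3) * t) * (μ * ‖p‖ + ‖q‖)) := by
      refine le_of_sq_le_sq ?_ (by positivity)
      rw [mul_pow √_, Real.sq_sqrt (by positivity)]
      exact (le_add_of_nonneg_right (by positivity)).trans (hN μ hμ p q t ht)
    have h3 := mul_le_mul_of_nonneg_left h (zero_le_one.trans hμ)
    refine h3.trans (le_of_eq (by ring))
  | more j ih1 ih2 =>
    obtain ⟨C₁, hC₁, ih1⟩ := ih1
    obtain ⟨C₂, hC₂, ih2⟩ := ih2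
    refine ⟨b * C₂ + K * C₁, by positivity, fun μ hμ p q t ht => ?_⟩
    have hμ0 : 0 < μ := zero_lt_one.trans_le hμ
    have hg : 0 ≤ Real.exp (-(ε / 3) * t) * (μ * ‖p‖ + ‖q‖) := by positivity
    have h3 : ‖oscDeriv b (μ ^ 2 - 1 + m) p q (j + 2) t‖
        ≤ b * ‖oscDeriv b (μ ^ 2 - 1 + m) p q (j + 1) t‖
          + K * μ ^ 2 * ‖oscDeriv b (μ ^ 2 - 1 + m) p q j t‖ := by
      rw [oscDeriv]
      refine (norm_sub_le _ _).trans ?_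
      rw [norm_neg, norm_smul, norm_smul, Real.norm_of_nonneg hb.le,
        Real.norm_of_nonneg (hc.le.trans (hκ μ hμ).1)]
      gcongr
      exact hK μ hμ
    calc μ * ‖oscDeriv b (μ ^ 2 - 1 + m) p q (j + 2) t‖
        ≤ b * (μ * ‖oscDeriv b (μ ^ 2 - 1 + m) p q (j + 1) t‖)
          + K * μ ^ 2 * (μ * ‖oscDeriv b (μ ^ 2 - 1 + m) p q j t‖) := by nlinarith
      _ ≤ b * (C₂ * Real.exp (-(ε / 3) * t) * μ ^ (j + 1) * (μ * ‖p‖ + ‖q‖))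
          + K * μ ^ 2 * (C₁ * Real.exp (-(ε / 3) * t) * μ ^ j * (μ * ‖p‖ + ‖q‖)) := by
          exact add_le_add (mul_le_mul_of_nonneg_left (ih2 μ hμ p q t ht) hb.le)
            (mul_le_mul_of_nonneg_left (ih1 μ hμ p q t ht) (by positivity))
      _ ≤ b * (C₂ * Real.exp (-(ε / 3) * t) * μ ^ (j + 2) * (μ * ‖p‖ + ‖q‖))
          + K * μ ^ 2 * (C₁ * Real.exp (-(ε / 3) * t) * μ ^ j * (μ * ‖p‖ + ‖q‖)) := by
          gcongr
          norm_num
      _ = _ := by ring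

/-! ### Differentiability in Sobolev norms of dominated families -/

/-- Dominated convergence in `L²`: the mean value inequality bounds the weighted difference
quotients by `g`, so their errors are bounded by `2g` and tend to 0 at every `ξ`. -/
theorem hasSobolevDerivWithinAt_of_dominated {γ : ℝ} {φ ψ : ℝ → Space d → ℂ} {g : Space d → ℝ}
    (hg : MemLp g 2) (hder : ∀ ξ t, HasDerivAt (fun t => φ t ξ) (ψ t ξ) t)
    (hbd : ∀ ξ t, 0 ≤ t → ‖besselSymbol γ ξ * ψ t ξ‖ ≤ g ξ) {x : ℝ → NCDual θ} {v : NCDual θ}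
    {A : Set ℝ} (hA : A ⊆ Set.Ici 0) {t : ℝ} (ht : 0 ≤ t)
    (hx : ∀ r, 0 ≤ r → Represents θ γ (φ r) (x r)) (hv : Represents θ γ (ψ t) v) :
    HasSobolevDerivWithinAt θ γ x v A t := by
  set q : ℝ → Space d → ℂ := fun r ξ =>
    besselSymbol γ ξ * ((((r - t)⁻¹ : ℝ) : ℂ) * (φ r ξ - φ t ξ) - ψ t ξ) with hq
  have hrep : ∀ r, 0 ≤ r → Represents θ γ
      (fun ξ => (((r - t)⁻¹ : ℝ) : ℂ) * (φ r ξ - φ t ξ) - ψ t ξ)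
      ((((r - t)⁻¹ : ℝ) : ℂ) • (x r - x t) - v) := fun r hr =>
    (((hx r hr).sub (hx t ht)).smul _).sub hv
  have hmem : ∀ᶠ r in 𝓝[A \ {t}] t, r ∈ A \ {t} := eventually_mem_nhdsWithin
  have hbound : ∀ r, r ∈ A \ {t} → ∀ ξ, ‖q r ξ‖ ≤ ‖2 * g ξ‖ := by
    intro r hr ξ
    have hg0 : 0 ≤ g ξ := (norm_nonneg _).trans (hbd ξ t ht)
    have h1 : ‖besselSymbol γ ξ * φ r ξ - besselSymbol γ ξ * φ t ξ‖ ≤ g ξ * ‖r - t‖ :=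
      (convex_Ici (0 : ℝ)).norm_image_sub_le_of_norm_hasDerivWithin_le
        (f := fun r => besselSymbol γ ξ * φ r ξ) (f' := fun r => besselSymbol γ ξ * ψ r ξ)
        (fun s _ => ((hder ξ s).const_mul _).hasDerivWithinAt) (fun s hs => hbd ξ s hs) ht
        (hA hr.1)
    have h2 : q r ξ = (((r - t)⁻¹ : ℝ) : ℂ)
        * (besselSymbol γ ξ * φ r ξ - besselSymbol γ ξ * φ t ξ) - besselSymbol γ ξ * ψ t ξ := by
      rw [hq]
      ring
    have h3 : 0 < ‖r - t‖ := norm_pos_iff.2 (sub_ne_zero.2 hr.2)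
    have h4 : ‖(((r - t)⁻¹ : ℝ) : ℂ)
        * (besselSymbol γ ξ * φ r ξ - besselSymbol γ ξ * φ t ξ)‖ ≤ g ξ := by
      rw [norm_mul, Complex.norm_real, norm_inv, inv_mul_le_iff₀ h3, mul_comm ‖r - t‖]
      exact h1
    rw [h2, Real.norm_of_nonneg (by positivity), two_mul]
    exact (norm_sub_le _ _).trans (add_le_add h4 (hbd ξ t ht))
  have hlim : ∀ ξ, Tendsto (fun r => q r ξ) (𝓝[A \ {t}] t) (𝓝 0) := by
    intro ξ
    have h1 := (hasDerivAt_iff_tendsto_slope.1 (hder ξ t)).mono_left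
      (nhdsWithin_mono t (fun r (hr : r ∈ A \ {t}) => hr.2))
    have h2 := (h1.sub_const (ψ t ξ)).const_mul (besselSymbol γ ξ)
    rw [sub_self, mul_zero] at h2
    refine h2.congr fun r => ?_
    rw [hq, slope_def_module, Complex.real_smul]
  have hint : Tendsto (fun r => ∫⁻ ξ, ‖q r ξ‖ₑ ^ (2 : ℝ)) (𝓝[A \ {t}] t) (𝓝 0) := by
    have h := tendsto_lintegral_filter_of_dominated_convergence' (μ := (volume : Measure (Space d)))
      (l := 𝓝[A \ {t}] t) (F := fun r ξ => ‖q r ξ‖ₑ ^ (2 : ℝ)) (f := fun _ => 0)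
      (fun ξ => ‖2 * g ξ‖ₑ ^ (2 : ℝ)) ?_ ?_ ?_ ?_
    · simpa using h
    · filter_upwards [hmem] with r hr
      exact (hrep r (hA hr.1)).1.1.enorm.pow_const _
    · filter_upwards [hmem] with r hr
      refine ae_of_all _ fun ξ => ENNReal.rpow_le_rpow ?_ (by norm_num)
      exact enorm_le_iff_norm_le.2 (hbound r hr ξ)
    · exact (lintegral_rpow_enorm_lt_top_of_eLpNorm_lt_top (p := 2) (by norm_num) (by norm_num)
        (hg.const_mul 2).2).ne
    · refine ae_of_all _ fun ξ => ?_
      have h1 := (ENNReal.continuous_rpow_const (y := 2)).tendsto _ |>.comp (hlim ξ).enorm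
      simpa [Function.comp_def] using h1
  have hnorm := ((ENNReal.continuous_rpow_const (y := 1 / 2)).tendsto 0).comp hint
  rw [ENNReal.zero_rpow_of_pos (by norm_num)] at hnorm
  refine hnorm.congr' ?_
  filter_upwards [hmem] with r hr
  rw [(hrep r (hA hr.1)).sobolevNorm_eq,
    eLpNorm_eq_lintegral_rpow_enorm_toReal (by norm_num) (by norm_num)]
  simp [hq]

/-! ### Existence of solutions -/

theorem norm_besselSymbol_add (γ γ' : ℝ) (ξ : Space d) :
    ‖besselSymbol (γ + γ') ξ‖ = ‖besselSymbol γ ξ‖ * ‖besselSymbol γ' ξ‖ := by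
  rw [besselSymbol_add, norm_mul]

theorem norm_besselSymbol_one_pow (j : ℕ) (ξ : Space d) :
    ‖besselSymbol 1 ξ‖ ^ j = ‖besselSymbol j ξ‖ := by
  induction j with
  | zero => simp [besselSymbol_zero]
  | succ j ih => rw [pow_succ, ih, ← norm_besselSymbol_add, Nat.cast_succ]

theorem norm_besselSymbol_one_sq (ξ : Space d) : ‖besselSymbol 1 ξ‖ ^ 2 = 1 + ‖ξ‖ ^ 2 := by
  rw [norm_besselSymbol_one_pow, norm_besselSymbol]
  simp

theorem one_le_norm_besselSymbol_one (ξ : Space d) : 1 ≤ ‖besselSymbol 1 ξ‖ := by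
  have h := norm_besselSymbol_mono zero_le_one ξ
  rwa [besselSymbol_zero, norm_one] at h

/-- The `j`-th time derivative of the Fourier transform of the solution with the data `f₀`,
`f₁`. -/
def waveSymbol (b m : ℝ) (f₀ f₁ : Space d → ℂ) (j : ℕ) (t : ℝ) (ξ : Space d) : ℂ :=
  oscDeriv b (‖ξ‖ ^ 2 + m) (f₀ ξ) (f₁ ξ) j t

theorem hasDerivAt_waveSymbol (b m : ℝ) (f₀ f₁ : Space d → ℂ) (j : ℕ) (ξ : Space d) (t : ℝ) :
    HasDerivAt (fun t => waveSymbol b m f₀ f₁ j t ξ) (waveSymbol b m f₀ f₁ (j + 1) t ξ) t :=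
  hasDerivAt_oscDeriv _ _ _ _ j t

/-- The oscillator bound at `μ = ‖besselSymbol 1 ξ‖`, multiplied by the weight of order `s - j`. The
order `s` enters only through this factor, so neither `δ` nor `C` depends on it. -/
theorem exists_waveSymbol_bound (d : ℕ) {b m : ℝ} (hb : 0 < b) (hm : 0 < m) :
    ∃ δ : ℝ, 0 < δ ∧ ∀ j : ℕ, ∃ C : ℝ, 0 < C ∧ ∀ (s : ℝ) (f₀ f₁ : Space d → ℂ) (ξ : Space d)
      (t : ℝ), 0 ≤ t → ‖besselSymbol (s - j) ξ * waveSymbol b m f₀ f₁ j t ξ‖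
        ≤ C * Real.exp (-δ * t) * (‖besselSymbol s ξ * f₀ ξ‖ + ‖besselSymbol (s - 1) ξ * f₁ ξ‖) := by
  obtain ⟨δ, hδ, h⟩ := exists_oscDeriv_bound hb hm
  refine ⟨δ, hδ, fun j => ?_⟩
  obtain ⟨C, hC, h⟩ := h j
  refine ⟨C, hC, fun s f₀ f₁ ξ t ht => ?_⟩
  have hμ := one_le_norm_besselSymbol_one ξ
  have h1 := h _ hμ (f₀ ξ) (f₁ ξ) t ht
  have h2 : ‖besselSymbol 1 ξ‖ ^ 2 - 1 + m = ‖ξ‖ ^ 2 + m := by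
    rw [norm_besselSymbol_one_sq]
    ring
  rw [h2] at h1
  have hj : ‖besselSymbol (s - j) ξ‖ * ‖besselSymbol 1 ξ‖ ^ j = ‖besselSymbol s ξ‖ := by
    rw [norm_besselSymbol_one_pow, ← norm_besselSymbol_add, sub_add_cancel]
  have hs : ‖besselSymbol (s - 1) ξ‖ * ‖besselSymbol 1 ξ‖ = ‖besselSymbol s ξ‖ := by
    rw [← norm_besselSymbol_add, sub_add_cancel]
  have h3 := mul_le_mul_of_nonneg_left h1 (norm_nonneg (besselSymbol (s - j) ξ))
  refine le_of_mul_le_mul_left ?_ (zero_lt_one.trans_le hμ)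
  simp only [norm_mul, waveSymbol]
  calc _ = ‖besselSymbol (s - j) ξ‖
        * (‖besselSymbol 1 ξ‖ * ‖oscDeriv b (‖ξ‖ ^ 2 + m) (f₀ ξ) (f₁ ξ) j t‖) := by ring
    _ ≤ _ := h3
    _ = C * Real.exp (-δ * t) * (‖besselSymbol (s - j) ξ‖ * ‖besselSymbol 1 ξ‖ ^ j)
        * (‖besselSymbol 1 ξ‖ * ‖f₀ ξ‖ + ‖f₁ ξ‖) := by ring
    _ = _ := by rw [hj, ← hs]; ring

theorem exists_waveSymbol_estimate (d : ℕ) {b m : ℝ} (hb : 0 < b) (hm : 0 < m) :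
    ∃ δ : ℝ, 0 < δ ∧ ∀ j : ℕ, ∃ C : ℝ, 0 < C ∧ ∀ (s : ℝ) (f₀ f₁ : Space d → ℂ),
      MemLp (fun ξ => besselSymbol s ξ * f₀ ξ) 2 →
      MemLp (fun ξ => besselSymbol (s - 1) ξ * f₁ ξ) 2 →
      (∃ g : Space d → ℝ, MemLp g 2 ∧ ∀ ξ t, 0 ≤ t →
        ‖besselSymbol (s - j) ξ * waveSymbol b m f₀ f₁ j t ξ‖ ≤ g ξ) ∧
      ∀ t, 0 ≤ t →
        MemLp (fun ξ => besselSymbol (s - j) ξ * waveSymbol b m f₀ f₁ j t ξ) 2 ∧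
        eLpNorm (fun ξ => besselSymbol (s - j) ξ * waveSymbol b m f₀ f₁ j t ξ) 2 volume
          ≤ ENNReal.ofReal (C * Real.exp (-δ * t)) *
            (eLpNorm (fun ξ => besselSymbol s ξ * f₀ ξ) 2 volume
              + eLpNorm (fun ξ => besselSymbol (s - 1) ξ * f₁ ξ) 2 volume) := by
  obtain ⟨δ, hδ, h⟩ := exists_waveSymbol_bound d hb hm
  refine ⟨δ, hδ, fun j => ?_⟩
  obtain ⟨C, hC, h⟩ := h j
  refine ⟨C, hC, fun s f₀ f₁ h₀ h₁ => ?_⟩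
  have hg : MemLp (fun ξ => ‖besselSymbol s ξ * f₀ ξ‖ + ‖besselSymbol (s - 1) ξ * f₁ ξ‖) 2 :=
    h₀.norm.add h₁.norm
  refine ⟨⟨_, hg.const_mul C, fun ξ t ht => (h s f₀ f₁ ξ t ht).trans ?_⟩, fun t ht => ?_⟩
  -- Dropping the decay leaves a majorant independent of `t`, as dominated convergence requires.
  · have h3 : Real.exp (-δ * t) ≤ 1 := Real.exp_le_one_iff.2 (by nlinarith)
    gcongr
    nlinarith
  · have hm : AEStronglyMeasurable
        (fun ξ => besselSymbol (s - j) ξ * waveSymbol b m f₀ f₁ j t ξ) :=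
      (continuous_besselSymbol _).aestronglyMeasurable.mul (aestronglyMeasurable_oscDeriv b
        (Continuous.aestronglyMeasurable (by fun_prop))
        (aestronglyMeasurable_of_besselSymbol_mul h₀.1)
        (aestronglyMeasurable_of_besselSymbol_mul h₁.1) j t)
    have hle : ∀ ξ, ‖besselSymbol (s - j) ξ * waveSymbol b m f₀ f₁ j t ξ‖ ≤
        C * Real.exp (-δ * t) *
          ‖‖besselSymbol s ξ * f₀ ξ‖ + ‖besselSymbol (s - 1) ξ * f₁ ξ‖‖ := fun ξ => by
      rw [Real.norm_of_nonneg (add_nonneg (norm_nonneg _) (norm_nonneg _))]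
      exact h s f₀ f₁ ξ t ht
    refine ⟨hg.of_le_mul hm (ae_of_all _ hle), ?_⟩
    refine (eLpNorm_le_mul_eLpNorm_of_ae_le_mul (ae_of_all _ hle) 2).trans ?_
    gcongr
    refine (eLpNorm_add_le h₀.norm.1 h₁.norm.1 (by norm_num)).trans (le_of_eq ?_)
    rw [eLpNorm_norm, eLpNorm_norm]

/-! ### Uniqueness of solutions -/

theorem exists_multiplication_clm {g : Space d → ℝ} (hg : Continuous g) {B : ℝ}
    (hB : ∀ ξ, ‖g ξ‖ ≤ B) :
    ∃ T : Hilb d →L[ℝ] Hilb d, ∀ X, T X =ᵐ[volume] fun ξ => g ξ • X ξ := by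
  have hm : MemLp g ∞ (volume : Measure (Space d)) :=
    memLp_top_of_bound hg.aestronglyMeasurable B (ae_of_all _ hB)
  refine ⟨(ContinuousLinearMap.lsmul ℝ ℝ).holderL volume ∞ 2 2 hm.toLp, fun X => ?_⟩
  filter_upwards [(ContinuousLinearMap.lsmul ℝ ℝ (E := ℂ)).coeFn_holder (r := 2) hm.toLp X,
    hm.coeFn_toLp] with ξ h1 h2
  refine h1.trans ?_
  rw [h2]
  rfl

/-- The natural energy `∫ |V|² + (|ξ|²+m)|Z|²` may be infinite when `Z` is merely in `L²`. Dividing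
its density by `1+|ξ|²` makes both multipliers bounded and keeps the identity `E' = -2b ∫
|V|²/(1+|ξ|²) ≤ 0`. As `E` vanishes at 0, it vanishes for all later times. -/
theorem dampedWave_eq_zero {b m : ℝ} (hb : 0 < b) (hm : 0 < m) {Z V W : ℝ → Hilb d}
    (hZ0 : Z 0 = 0) (hV0 : V 0 = 0)
    (hZ : ∀ t, 0 ≤ t → HasDerivWithinAt Z (V t) (Set.Ici 0) t)
    (hVc : ContinuousWithinAt V (Set.Ioi 0) 0) (hV : ∀ t, 0 < t → HasDerivAt V (W t) t)
    (heq : ∀ t, 0 < t → W t =ᵐ[volume] fun ξ => -(b • V t ξ) - (‖ξ‖ ^ 2 + m) • Z t ξ)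
    {t : ℝ} (ht : 0 ≤ t) : Z t = 0 := by
  have hpos : ∀ ξ : Space d, 0 < 1 + ‖ξ‖ ^ 2 := fun ξ => by positivity
  obtain ⟨T₁, hT₁⟩ := exists_multiplication_clm (d := d) (g := fun ξ => √(1 / (1 + ‖ξ‖ ^ 2)))
    (Real.continuous_sqrt.comp (continuous_const.div (by fun_prop) fun ξ => (hpos ξ).ne'))
    (B := √1) fun ξ => by
      rw [Real.norm_of_nonneg (Real.sqrt_nonneg _)]
      refine Real.sqrt_le_sqrt ?_
      rw [div_le_one (hpos ξ)]
      nlinarith [sq_nonneg ‖ξ‖]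
  obtain ⟨T₂, hT₂⟩ := exists_multiplication_clm (d := d)
    (g := fun ξ => √((‖ξ‖ ^ 2 + m) / (1 + ‖ξ‖ ^ 2)))
    (Real.continuous_sqrt.comp (Continuous.div (by fun_prop) (by fun_prop) fun ξ => (hpos ξ).ne'))
    (B := √(1 + m)) fun ξ => by
      rw [Real.norm_of_nonneg (Real.sqrt_nonneg _)]
      refine Real.sqrt_le_sqrt ?_
      rw [div_le_iff₀ (hpos ξ)]
      nlinarith [sq_nonneg ‖ξ‖]
  set E : ℝ → ℝ := fun t => ‖T₁ (V t)‖ ^ 2 + ‖T₂ (Z t)‖ ^ 2 with hE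
  have hZat : ∀ t, 0 < t → HasDerivAt Z (V t) t := fun t ht =>
    (hZ t ht.le).hasDerivAt (Ici_mem_nhds ht)
  have hE' : ∀ t, 0 < t → HasDerivAt E
      (2 * inner ℝ (T₁ (V t)) (T₁ (W t)) + 2 * inner ℝ (T₂ (Z t)) (T₂ (V t))) t := fun t ht =>
    ((T₁.hasFDerivAt.comp_hasDerivAt t (hV t ht)).norm_sq).add
      ((T₂.hasFDerivAt.comp_hasDerivAt t (hZat t ht)).norm_sq)
  have hle : ∀ t, 0 < t →
      2 * inner ℝ (T₁ (V t)) (T₁ (W t)) + 2 * inner ℝ (T₂ (Z t)) (T₂ (V t)) ≤ 0 := by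
    intro t ht
    rw [← mul_add, L2.inner_def, L2.inner_def,
      ← integral_add (L2.integrable_inner _ _) (L2.integrable_inner _ _)]
    refine mul_nonpos_of_nonneg_of_nonpos zero_le_two (integral_nonpos_of_ae ?_)
    filter_upwards [hT₁ (V t), hT₁ (W t), hT₂ (Z t), hT₂ (V t), heq t ht] with ξ h1 h2 h3 h4 h5
    simp only [Pi.zero_apply]
    rw [h1, h2, h3, h4, h5]
    simp only [real_inner_smul_left, real_inner_smul_right, inner_sub_right, inner_neg_right,
      ← mul_assoc]
    have hκ : 0 ≤ (‖ξ‖ ^ 2 + m) / (1 + ‖ξ‖ ^ 2) := by positivity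
    have hs := Real.mul_self_sqrt (by positivity : 0 ≤ 1 / (1 + ‖ξ‖ ^ 2))
    rw [Real.mul_self_sqrt hκ, real_inner_comm (Z t ξ) (V t ξ), real_inner_self_eq_norm_sq]
    refine le_of_eq_of_le (b := -(b * ‖V t ξ‖ ^ 2 / (1 + ‖ξ‖ ^ 2))) ?_
      (neg_nonpos.2 (by positivity))
    -- The terms pairing `Z` with `V` cancel because both weights have the same denominator; only
    -- the damping remains.
    linear_combination
      (-(b * ‖V t ξ‖ ^ 2) - (‖ξ‖ ^ 2 + m) * inner ℝ (Z t ξ) (V t ξ)) * hs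
  have hVcont : ContinuousOn V (Set.Ici 0) := by
    intro t ht
    rcases (Set.mem_Ici.1 ht).eq_or_lt with rfl | ht
    · exact continuousWithinAt_Ioi_iff_Ici.1 hVc
    · exact (hV t ht).continuousAt.continuousWithinAt
  have hanti : AntitoneOn E (Set.Ici 0) := by
    refine antitoneOn_of_deriv_nonpos (convex_Ici 0) ?_ ?_ ?_
    · exact ((T₁.continuous.comp_continuousOn hVcont).norm.pow 2).add
        ((T₂.continuous.comp_continuousOn fun t ht => (hZ t ht).continuousWithinAt).norm.pow 2)
    · rw [interior_Ici]
      exact fun t ht => (hE' t ht).differentiableAt.differentiableWithinAt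
    · rw [interior_Ici]
      intro t ht
      rw [(hE' t ht).deriv]
      exact hle t ht
  have h1 := hanti Set.self_mem_Ici ht ht
  simp only [hE, hZ0, hV0, map_zero, norm_zero] at h1
  have h2 : ‖T₂ (Z t)‖ ^ 2 ≤ 0 := by nlinarith [sq_nonneg ‖T₁ (V t)‖]
  have h3 : T₂ (Z t) = 0 := by
    rw [← norm_eq_zero]
    exact pow_eq_zero_iff two_ne_zero |>.1 (le_antisymm h2 (sq_nonneg _))
  have h4 := hT₂ (Z t)
  rw [h3] at h4
  refine Lp.ext ?_
  filter_upwards [h4, Lp.coeFn_zero ℂ 2 (volume : Measure (Space d))] with ξ h5 h6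
  rw [h6] at h5 ⊢
  -- The multiplier of `T₂` has no zero, not even at `ξ = 0`, since `m > 0`.
  refine (smul_eq_zero.1 h5.symm).resolve_left (Real.sqrt_ne_zero'.2 ?_)
  positivity

open Classical in
/-- The Fourier transform of `(1 - Δ_θ)^{γ/2} u` for `u ∈ H^γ(ℝ^d_θ)`. -/
def sobolevFourier (θ : SkewMatrix d) (γ : ℝ) (u : NCDual θ) : Hilb d :=
  if h : ∃ f, Represents θ γ f u then h.choose_spec.1.toLp else 0

theorem Represents.sobolevFourier_eq {γ : ℝ} {f : Space d → ℂ} {u : NCDual θ}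
    (h : Represents θ γ f u) : sobolevFourier θ γ u = h.1.toLp := by
  have hex : ∃ f, Represents θ γ f u := ⟨f, h⟩
  rw [sobolevFourier, dif_pos hex]
  refine MemLp.toLp_congr _ _ ?_
  filter_upwards [hex.choose_spec.ae_eq h] with ξ hξ
  rw [hξ]

theorem Represents.coeFn_sobolevFourier {γ : ℝ} {f : Space d → ℂ} {u : NCDual θ}
    (h : Represents θ γ f u) :
    sobolevFourier θ γ u =ᵐ[volume] fun ξ => besselSymbol γ ξ * f ξ := by
  rw [h.sobolevFourier_eq]
  exact h.1.coeFn_toLp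

/-! ### Sobolev-valued curves as curves in `L²(ℝ^d)` -/

theorem sobolevFourier_sub {γ : ℝ} {u v : NCDual θ} (hu : MemSobolev θ γ u)
    (hv : MemSobolev θ γ v) :
    sobolevFourier θ γ (u - v) = sobolevFourier θ γ u - sobolevFourier θ γ v := by
  obtain ⟨f, hf⟩ := memSobolev_iff.1 hu
  obtain ⟨g, hg⟩ := memSobolev_iff.1 hv
  rw [hf.sobolevFourier_eq, hg.sobolevFourier_eq, (hf.sub hg).sobolevFourier_eq,
    ← MemLp.toLp_sub]
  exact MemLp.toLp_congr _ _ (ae_of_all _ fun ξ => by simp [mul_sub])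

theorem sobolevFourier_smul {γ : ℝ} {u : NCDual θ} (c : ℂ) (hu : MemSobolev θ γ u) :
    sobolevFourier θ γ (c • u) = c • sobolevFourier θ γ u := by
  obtain ⟨f, hf⟩ := memSobolev_iff.1 hu
  rw [hf.sobolevFourier_eq, (hf.smul c).sobolevFourier_eq, ← MemLp.toLp_const_smul]
  exact MemLp.toLp_congr _ _ (ae_of_all _ fun ξ => by simp; ring)

theorem enorm_sobolevFourier {γ : ℝ} {u : NCDual θ} (hu : MemSobolev θ γ u) :
    ‖sobolevFourier θ γ u‖ₑ = sobolevNorm θ γ u := by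
  obtain ⟨f, hf⟩ := memSobolev_iff.1 hu
  rw [hf.sobolevFourier_eq, hf.sobolevNorm_eq, Lp.enorm_toLp]

theorem MemSobolev.sub {γ : ℝ} {u v : NCDual θ} (hu : MemSobolev θ γ u)
    (hv : MemSobolev θ γ v) : MemSobolev θ γ (u - v) := by
  obtain ⟨f, hf⟩ := memSobolev_iff.1 hu
  obtain ⟨g, hg⟩ := memSobolev_iff.1 hv
  exact memSobolev_iff.2 ⟨_, hf.sub hg⟩

theorem MemSobolev.smul {γ : ℝ} {u : NCDual θ} (c : ℂ) (hu : MemSobolev θ γ u) :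
    MemSobolev θ γ (c • u) := by
  obtain ⟨f, hf⟩ := memSobolev_iff.1 hu
  exact memSobolev_iff.2 ⟨_, hf.smul c⟩

/-- Since `sobolevNorm` is `∞` outside `H^γ`, convergence to 0 puts some difference quotient minus
`v` in `H^γ`, hence `v` itself; `hS` excludes a vacuous limit. Then `sobolevFourier` is isometric
and carries the derivative over. -/
theorem HasSobolevDerivWithinAt.hasDerivWithinAt {γ : ℝ} {x : ℝ → NCDual θ} {v : NCDual θ}
    {S : Set ℝ} {t : ℝ} (h : HasSobolevDerivWithinAt θ γ x v S t)
    (hx : ∀ r ∈ S, MemSobolev θ γ (x r)) (ht : t ∈ S) (hS : (𝓝[S \ {t}] t).NeBot) :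
    MemSobolev θ γ v ∧ HasDerivWithinAt (fun r => sobolevFourier θ γ (x r))
      (sobolevFourier θ γ v) S t := by
  have hq : ∀ r ∈ S, MemSobolev θ γ ((((r - t)⁻¹ : ℝ) : ℂ) • (x r - x t)) := fun r hr =>
    ((hx r hr).sub (hx t ht)).smul _
  have hmem : ∀ᶠ r in 𝓝[S \ {t}] t, r ∈ S \ {t} := eventually_mem_nhdsWithin
  have hv : MemSobolev θ γ v := by
    obtain ⟨r, hr, hrS⟩ := ((h.eventually_lt_const ENNReal.zero_lt_top).and hmem).exists
    have h1 : MemSobolev θ γ ((((r - t)⁻¹ : ℝ) : ℂ) • (x r - x t) - v) := by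
      by_contra hc
      rw [sobolevNorm_eq_top hc] at hr
      exact lt_irrefl _ hr
    have h2 := (hq r hrS.1).sub h1
    rwa [sub_sub_cancel] at h2
  refine ⟨hv, ?_⟩
  rw [hasDerivWithinAt_iff_tendsto_slope, tendsto_iff_edist_tendsto_0]
  refine h.congr' ?_
  filter_upwards [hmem] with r hr
  rw [edist_eq_enorm_sub, ← enorm_sobolevFourier ((hq r hr.1).sub hv),
    sobolevFourier_sub (hq r hr.1) hv, sobolevFourier_smul _ ((hx r hr.1).sub (hx t ht)),
    sobolevFourier_sub (hx r hr.1) (hx t ht), slope_def_module]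
  congr 2

theorem nhdsWithin_Ici_diff_neBot {t : ℝ} (ht : 0 ≤ t) : (𝓝[Set.Ici 0 \ {t}] t).NeBot :=
  (inferInstance : (𝓝[>] t).NeBot).mono (nhdsWithin_mono t fun _ hr =>
    ⟨ht.trans (Set.mem_Ioi.1 hr).le, (Set.mem_Ioi.1 hr).ne'⟩)

theorem nhdsWithin_Ioi_diff_neBot {t : ℝ} (ht : 0 < t) : (𝓝[Set.Ioi 0 \ {t}] t).NeBot :=
  (inferInstance : (𝓝[>] t).NeBot).mono (nhdsWithin_mono t fun _ hr =>
    ⟨ht.trans (Set.mem_Ioi.1 hr), (Set.mem_Ioi.1 hr).ne'⟩)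

/-- Every order below that of the solution is allowed, so that two solutions of different orders can
be placed in one space. -/
theorem IsDampedWaveSolution.exists_sobolevFourier {b m : ℝ} {x₀ x₁ : NCDual θ}
    {x : ℝ → NCDual θ} (h : IsDampedWaveSolution θ b m x₀ x₁ x) :
    ∃ r : ℝ, ∀ γ ≤ r, ∃ V W : ℝ → Hilb d,
      (∀ t, 0 ≤ t → MemSobolev θ γ (x t)) ∧ x 0 = x₀ ∧ V 0 = sobolevFourier θ γ x₁ ∧
      (∀ t, 0 ≤ t → HasDerivWithinAt (fun t => sobolevFourier θ γ (x t)) (V t) (Set.Ici 0) t) ∧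
      ContinuousWithinAt V (Set.Ioi 0) 0 ∧ (∀ t, 0 < t → HasDerivAt V (W t) t) ∧
      ∀ t, 0 < t → W t =ᵐ[volume]
        fun ξ => -(b • V t ξ) - (‖ξ‖ ^ 2 + m) • sobolevFourier θ γ (x t) ξ := by
  obtain ⟨r, v, w, hx0, hv0, hmem, hx, hvc, hv, heq⟩ := h
  refine ⟨r, fun γ hγ => ⟨fun t => sobolevFourier θ γ (v t), fun t => sobolevFourier θ γ (w t),
    fun t ht => (hmem t ht).1.mono hγ, hx0, by simp only [hv0], fun t ht => ?_, ?_,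
    fun t ht => ?_, fun t ht => ?_⟩⟩
  · exact (((hx t ht).mono_order hγ).hasDerivWithinAt (fun r hr => (hmem r hr).1.mono hγ) ht
      (nhdsWithin_Ici_diff_neBot ht)).2
  · rw [ContinuousWithinAt, tendsto_iff_edist_tendsto_0]
    have h1 := tendsto_of_tendsto_of_tendsto_of_le_of_le tendsto_const_nhds hvc
      (fun _ => zero_le) (fun t => sobolevNorm_mono hγ (v t - v 0))
    refine h1.congr' ?_
    filter_upwards [self_mem_nhdsWithin] with t ht
    have h2 := (hmem t (Set.mem_Ioi.1 ht).le).2.mono hγ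
    have h3 := (hmem 0 le_rfl).2.mono hγ
    rw [← enorm_sobolevFourier (h2.sub h3), sobolevFourier_sub h2 h3, edist_eq_enorm_sub]
  · exact (((hv t ht).mono_order hγ).hasDerivWithinAt
      (fun r hr => (hmem r (Set.mem_Ioi.1 hr).le).2.mono hγ) ht
      (nhdsWithin_Ioi_diff_neBot ht)).2.hasDerivAt (Ioi_mem_nhds ht)
  · obtain ⟨f, hf⟩ := memSobolev_iff.1 ((hmem t ht.le).1.mono hγ)
    obtain ⟨g, hg⟩ := memSobolev_iff.1 ((hmem t ht.le).2.mono hγ)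
    obtain ⟨k, hk⟩ := memSobolev_iff.1 (((hv t ht).mono_order hγ).hasDerivWithinAt
      (fun r hr => (hmem r (Set.mem_Ioi.1 hr).le).2.mono hγ) ht (nhdsWithin_Ioi_diff_neBot ht)).1
    -- The Laplacian lives only in `H^{γ-2}`, so the equation is read there as an identity of
    -- transforms almost everywhere and then multiplied by the weight of order `γ`.
    have hlow : γ - 2 ≤ γ := by linarith
    have h1 := (((hk.mono hlow).sub hf.laplacian).add ((hg.mono hlow).smul (b : ℂ))).add
      ((hf.mono hlow).smul (m : ℂ))
    rw [heq t ht] at h1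
    filter_upwards [hf.coeFn_sobolevFourier, hg.coeFn_sobolevFourier, hk.coeFn_sobolevFourier,
      h1.ae_eq (represents_zero 0)] with ξ e1 e2 e3 e4
    rw [e1, e2, e3]
    simp only [Complex.real_smul]
    push_cast at e4 ⊢
    linear_combination besselSymbol γ ξ * e4

theorem IsDampedWaveSolution.eq {b m : ℝ} (hb : 0 < b) (hm : 0 < m) {x₀ x₁ : NCDual θ}
    {x y : ℝ → NCDual θ} (hx : IsDampedWaveSolution θ b m x₀ x₁ x)
    (hy : IsDampedWaveSolution θ b m x₀ x₁ y) {t : ℝ} (ht : 0 ≤ t) : x t = y t := by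
  obtain ⟨r, hx⟩ := hx.exists_sobolevFourier
  obtain ⟨r', hy⟩ := hy.exists_sobolevFourier
  obtain ⟨V, W, hxm, hx0, hV0, hxd, hVc, hV, hxe⟩ := hx _ (min_le_left r r')
  obtain ⟨V', W', hym, hy0, hV0', hyd, hVc', hV', hye⟩ := hy _ (min_le_right r r')
  have h := dampedWave_eq_zero hb hm
    (Z := fun t => sobolevFourier θ (min r r') (x t) - sobolevFourier θ (min r r') (y t))
    (V := fun t => V t - V' t) (W := fun t => W t - W' t) (by simp only [hx0, hy0, sub_self])
    (by simp only [hV0, hV0', sub_self]) (fun t ht => (hxd t ht).sub (hyd t ht)) (hVc.sub hVc')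
    (fun t ht => (hV t ht).sub (hV' t ht)) (fun t ht => ?_) ht
  · obtain ⟨f, hf⟩ := memSobolev_iff.1 (hxm t ht)
    obtain ⟨g, hg⟩ := memSobolev_iff.1 (hym t ht)
    refine hf.ext hg ?_
    have h1 := hf.coeFn_sobolevFourier
    rw [sub_eq_zero.1 h] at h1
    filter_upwards [h1, hg.coeFn_sobolevFourier] with ξ e1 e2
    exact mul_left_cancel₀ (besselSymbol_ne_zero _ ξ) (e1.symm.trans e2)
  · filter_upwards [hxe t ht, hye t ht, Lp.coeFn_sub (W t) (W' t), Lp.coeFn_sub (V t) (V' t),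
      Lp.coeFn_sub (sobolevFourier θ (min r r') (x t)) (sobolevFourier θ (min r r') (y t))]
      with ξ e1 e2 e3 e4 e5
    rw [e3, e4, e5, Pi.sub_apply, Pi.sub_apply, Pi.sub_apply, e1, e2, smul_sub, smul_sub]
    abel

/-! ### Existence of solutions and decay of their time derivatives -/

theorem memLp_besselSymbol_waveSymbol {b m : ℝ} (hb : 0 < b) (hm : 0 < m) {s : ℝ}
    {f₀ f₁ : Space d → ℂ} (h₀ : MemLp (fun ξ => besselSymbol s ξ * f₀ ξ) 2)
    (h₁ : MemLp (fun ξ => besselSymbol (s - 1) ξ * f₁ ξ) 2) (j : ℕ) {t : ℝ} (ht : 0 ≤ t) :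
    MemLp (fun ξ => besselSymbol (s - j) ξ * waveSymbol b m f₀ f₁ j t ξ) 2 := by
  obtain ⟨δ, -, h⟩ := exists_waveSymbol_estimate d hb hm
  obtain ⟨C, -, h⟩ := h j
  exact ((h s f₀ f₁ h₀ h₁).2 t ht).1

theorem exists_represents_waveSymbol (θ : SkewMatrix d) {b m : ℝ} (hb : 0 < b) (hm : 0 < m)
    {s : ℝ} {f₀ f₁ : Space d → ℂ} (h₀ : MemLp (fun ξ => besselSymbol s ξ * f₀ ξ) 2)
    (h₁ : MemLp (fun ξ => besselSymbol (s - 1) ξ * f₁ ξ) 2) :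
    ∃ D : ℕ → ℝ → NCDual θ, ∀ (j : ℕ) (t : ℝ), 0 ≤ t →
      Represents θ (s - j) (waveSymbol b m f₀ f₁ j t) (D j t) := by
  have h : ∀ (j : ℕ) (t : ℝ), ∃ u : NCDual θ, 0 ≤ t →
      Represents θ (s - j) (waveSymbol b m f₀ f₁ j t) u := by
    intro j t
    by_cases ht : 0 ≤ t
    · obtain ⟨u, hu⟩ := exists_represents θ (memLp_besselSymbol_waveSymbol hb hm h₀ h₁ j ht)
      exact ⟨u, fun _ => hu⟩
    -- An arbitrary value: negative times never matter.
    · exact ⟨0, fun h => absurd h ht⟩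
  choose D hD using h
  exact ⟨D, hD⟩

theorem hasSobolevDerivWithinAt_waveSymbol {b m : ℝ} (hb : 0 < b) (hm : 0 < m)
    {s : ℝ} {f₀ f₁ : Space d → ℂ} (h₀ : MemLp (fun ξ => besselSymbol s ξ * f₀ ξ) 2)
    (h₁ : MemLp (fun ξ => besselSymbol (s - 1) ξ * f₁ ξ) 2) {j : ℕ} {x y : ℝ → NCDual θ}
    (hx : ∀ t, 0 ≤ t → Represents θ (s - j) (waveSymbol b m f₀ f₁ j t) (x t)) {t : ℝ}
    (ht : 0 ≤ t)
    (hy : Represents θ (s - (j + 1 : ℕ)) (waveSymbol b m f₀ f₁ (j + 1) t) (y t))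
    {A : Set ℝ} (hA : A ⊆ Set.Ici 0) :
    HasSobolevDerivWithinAt θ (s - (j + 1 : ℕ)) x (y t) A t := by
  obtain ⟨δ, -, h⟩ := exists_waveSymbol_estimate d hb hm
  obtain ⟨C, -, h⟩ := h (j + 1)
  obtain ⟨g, hg, hbd⟩ := (h s f₀ f₁ h₀ h₁).1
  exact hasSobolevDerivWithinAt_of_dominated hg (hasDerivAt_waveSymbol b m f₀ f₁ j) hbd hA ht
    (fun r hr => (hx r hr).mono (by push_cast; linarith)) hy

theorem isDampedWaveSolution_waveSymbol {b m : ℝ} (hb : 0 < b) (hm : 0 < m)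
    {s : ℝ} {f₀ f₁ : Space d → ℂ} {x₀ x₁ : NCDual θ} (h₀ : Represents θ s f₀ x₀)
    (h₁ : Represents θ (s - 1) f₁ x₁) {D : ℕ → ℝ → NCDual θ}
    (hD : ∀ (j : ℕ) (t : ℝ), 0 ≤ t → Represents θ (s - j) (waveSymbol b m f₀ f₁ j t) (D j t)) :
    IsDampedWaveSolution θ b m x₀ x₁ (D 0) := by
  have hle : ∀ j : ℕ, j ≤ 2 → s - 2 ≤ s - j := fun j hj => by
    have : (j : ℝ) ≤ 2 := by exact_mod_cast hj
    linarith
  have hder : ∀ j : ℕ, j + 1 ≤ 2 → ∀ {A : Set ℝ}, A ⊆ Set.Ici 0 → ∀ t, 0 ≤ t →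
      HasSobolevDerivWithinAt θ (s - 2) (D j) (D (j + 1) t) A t := fun j hj A hA t ht =>
    (hasSobolevDerivWithinAt_waveSymbol hb hm h₀.1 h₁.1 (hD j) ht (hD (j + 1) t ht) hA).mono_order
      (hle _ hj)
  have hmem : ∀ j : ℕ, j ≤ 2 → ∀ t, 0 ≤ t → MemSobolev θ (s - 2) (D j t) := fun j hj t ht =>
    memSobolev_iff.2 ⟨_, (hD j t ht).mono (hle j hj)⟩
  -- The order `s - 2` accommodates two time derivatives, at one order each, and the Laplacian.
  refine ⟨s - 2, D 1, D 2, ?_, ?_, fun t ht => ⟨hmem 0 (by norm_num) t ht,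
    hmem 1 (by norm_num) t ht⟩, hder 0 (by norm_num) subset_rfl, ?_,
    fun t ht => hder 1 (by norm_num) Set.Ioi_subset_Ici_self t ht.le, fun t ht => ?_⟩
  · exact (hD 0 0 le_rfl).ext h₀ (ae_of_all _ fun ξ => oscDeriv_zero_zero _ _ _ _)
  · exact (hD 1 0 le_rfl).ext h₁ (ae_of_all _ fun ξ => oscDeriv_one_zero _ _ _ _)
  · have h2 := ((hder 1 (by norm_num) subset_rfl 0 le_rfl).hasDerivWithinAt
      (fun r hr => hmem 1 (by norm_num) r hr) Set.self_mem_Ici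
      (nhdsWithin_Ici_diff_neBot le_rfl)).2.continuousWithinAt.mono Set.Ioi_subset_Ici_self
    rw [ContinuousWithinAt, tendsto_iff_edist_tendsto_0] at h2
    refine h2.congr' ?_
    filter_upwards [self_mem_nhdsWithin] with t ht
    have h3 := hmem 1 (by norm_num) t (Set.mem_Ioi.1 ht).le
    have h4 := hmem 1 (by norm_num) 0 le_rfl
    rw [← enorm_sobolevFourier (h3.sub h4), sobolevFourier_sub h3 h4, edist_eq_enorm_sub]
  · have e0 := (hD 0 t ht.le).laplacian.mono (by simp : s - 2 ≤ s - (0 : ℕ) - 2)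
    have e1 := (hD 1 t ht.le).mono (hle 1 (by norm_num))
    have e2 := (hD 2 t ht.le).mono (hle 2 le_rfl)
    have e3 := (hD 0 t ht.le).mono (hle 0 (by norm_num))
    refine (((e2.sub e0).add (e1.smul (b : ℂ))).add (e3.smul (m : ℂ))).ext
      (represents_zero 0) (ae_of_all _ fun ξ => ?_)
    simp only [waveSymbol, oscDeriv, Complex.real_smul]
    push_cast
    ring

/-- The time derivatives of a solution decay exponentially, at a rate that depends only on the
equation. -/
theorem exists_decay_timeDeriv (θ : SkewMatrix d) {b m : ℝ} (hb : 0 < b) (hm : 0 < m) :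
    ∃ δ : ℝ, 0 < δ ∧ ∀ α : ℕ, ∃ C : ℝ, 0 < C ∧ ∀ (s : ℝ) (x₀ x₁ : NCDual θ),
      MemSobolev θ s x₀ → MemSobolev θ (s - 1) x₁ →
      (∃ x, IsDampedWaveSolution θ b m x₀ x₁ x) ∧
      ∀ x, IsDampedWaveSolution θ b m x₀ x₁ x →
        ∃ D : ℕ → ℝ → NCDual θ, IsIteratedTimeDeriv θ (s - α) α x D ∧
          ∀ t, 0 < t → MemSobolev θ (s - α) (D α t) ∧
            sobolevNorm θ (s - α) (D α t) ≤ ENNReal.ofReal (C * Real.exp (-δ * t)) *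
              (sobolevNorm θ s x₀ + sobolevNorm θ (s - 1) x₁) := by
  obtain ⟨δ, hδ, hest⟩ := exists_waveSymbol_estimate d hb hm
  refine ⟨δ, hδ, fun α => ?_⟩
  obtain ⟨C, hC, hest⟩ := hest α
  refine ⟨C, hC, fun s x₀ x₁ hx₀ hx₁ => ?_⟩
  obtain ⟨f₀, h₀⟩ := memSobolev_iff.1 hx₀
  obtain ⟨f₁, h₁⟩ := memSobolev_iff.1 hx₁
  obtain ⟨D, hD⟩ := exists_represents_waveSymbol θ hb hm h₀.1 h₁.1
  have hsol := isDampedWaveSolution_waveSymbol hb hm h₀ h₁ hD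
  refine ⟨⟨D 0, hsol⟩, fun x hx => ?_⟩
  -- `IsIteratedTimeDeriv` asks for `D 0 = x` at all times, whereas uniqueness gives `x = D 0` only
  -- for `t ≥ 0`; hence the entry at 0 is replaced.
  set D' : ℕ → ℝ → NCDual θ := fun j => if j = 0 then x else D j with hD'_def
  have hD' : ∀ (j : ℕ) (t : ℝ), 0 ≤ t → Represents θ (s - j) (waveSymbol b m f₀ f₁ j t) (D' j t) := by
    intro j t ht
    by_cases hj : j = 0
    · subst hj
      simp only [hD'_def, if_true]
      rw [hx.eq hb hm hsol ht]
      exact hD 0 t ht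
    · simp only [hD'_def, if_neg hj]
      exact hD j t ht
  refine ⟨D', ⟨if_pos rfl, fun j hj t ht => ?_⟩, fun t ht => ?_⟩
  -- The derivative of `D' j` exists in the norm of order `s - (j + 1)`, which is at least the
  -- common order `s - α`.
  · have hle : ((j + 1 : ℕ) : ℝ) ≤ α := by exact_mod_cast hj
    exact (hasSobolevDerivWithinAt_waveSymbol hb hm h₀.1 h₁.1 (hD' j) ht.le (hD' (j + 1) t ht.le)
      Set.Ioi_subset_Ici_self).mono_order (by linarith)
  · have h := hD' α t ht.le
    refine ⟨memSobolev_iff.2 ⟨_, h⟩, ?_⟩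
    rw [h.sobolevNorm_eq, h₀.sobolevNorm_eq, h₁.sobolevNorm_eq]
    exact ((hest s f₀ f₁ h₀.1 h₁.1).2 t ht.le).2

end NCEuclidean

end

theorem mainTheorem10 (d : ℕ) (hd : 1 ≤ d) (θ : NCEuclidean.SkewMatrix d) (b m : ℝ)
    (hb : 0 < b) (hm : 0 < m) :
    ∃ δ : ℝ, 0 < δ ∧
      (∀ s : ℝ, ∃ C : ℝ, 0 < C ∧ ∀ x₀ x₁ : NCEuclidean.NCDual θ,
        NCEuclidean.MemSobolev θ s x₀ → NCEuclidean.MemSobolev θ (s - 1) x₁ →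
        (∃ x : ℝ → NCEuclidean.NCDual θ, NCEuclidean.IsDampedWaveSolution θ b m x₀ x₁ x) ∧
        ∀ x : ℝ → NCEuclidean.NCDual θ, NCEuclidean.IsDampedWaveSolution θ b m x₀ x₁ x →
          ∀ t : ℝ, 0 < t → NCEuclidean.MemSobolev θ s (x t) ∧
            NCEuclidean.sobolevNorm θ s (x t) ≤ ENNReal.ofReal (C * Real.exp (-δ * t)) *
              (NCEuclidean.sobolevNorm θ s x₀ + NCEuclidean.sobolevNorm θ (s - 1) x₁)) ∧
      (∀ (s : ℝ) (α : ℕ), ∃ C : ℝ, 0 < C ∧ ∀ x₀ x₁ : NCEuclidean.NCDual θ,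
        NCEuclidean.MemSobolev θ (α + s) x₀ → NCEuclidean.MemSobolev θ (α + s - 1) x₁ →
        ∀ x : ℝ → NCEuclidean.NCDual θ, NCEuclidean.IsDampedWaveSolution θ b m x₀ x₁ x →
          ∃ D : ℕ → ℝ → NCEuclidean.NCDual θ, NCEuclidean.IsIteratedTimeDeriv θ s α x D ∧
            ∀ t : ℝ, 0 < t → NCEuclidean.MemSobolev θ s (D α t) ∧
              NCEuclidean.sobolevNorm θ s (D α t) ≤ ENNReal.ofReal (C * Real.exp (-δ * t)) *
                (NCEuclidean.sobolevNorm θ (α + s) x₀ +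
                  NCEuclidean.sobolevNorm θ (α + s - 1) x₁)) := by
  obtain ⟨δ, hδ, h⟩ := NCEuclidean.exists_decay_timeDeriv θ hb hm
  refine ⟨δ, hδ, fun s => ?_, fun s α => ?_⟩
  -- Decay of the solution itself is the case of no time derivative.
  · obtain ⟨C, hC, h⟩ := h 0
    refine ⟨C, hC, fun x₀ x₁ hx₀ hx₁ => ⟨(h s x₀ x₁ hx₀ hx₁).1, fun x hx t ht => ?_⟩⟩
    obtain ⟨D, ⟨hD0, -⟩, hD⟩ := (h s x₀ x₁ hx₀ hx₁).2 x hx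
    have h0 := hD t ht
    rwa [hD0, Nat.cast_zero, sub_zero] at h0
  · obtain ⟨C, hC, h⟩ := h α
    refine ⟨C, hC, fun x₀ x₁ hx₀ hx₁ x hx => ?_⟩
    -- Data of order `α + s` leave order `s` after `α` derivatives.
    have h0 := (h (α + s) x₀ x₁ hx₀ hx₁).2 x hx
    rwa [add_sub_cancel_left] at h0
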